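/- **The data.** Let $B=F_0,F_1,F_2,\dots$ be smooth manifolds, for each $i\ge 1$ let $1\to H_i\to G_i\to K_i\to 1$ be a central extension of Lie groups such that $G_i\to K_i$ has smooth local sections, with $G_i$ acting smoothly and faithfully on $F_i$, and let $p_{K_i}$ be a principal $K_i$-bundle over $F_{i-1}$. For $i\ge 2$ the action of $G_{i-1}$ on $F_{i-1}$ is lifted to $p_{K_i}$, so that $p_{K_i}$ induces a $K_i$-bundle on every bundle with typical fibre $F_{i-1}$ and structure group $G_{i-1}$. The first $n$ of these data define the $n$-lifting problem (a finite sequence is continued by trivial groups and one-point fibres). Fix objects of the tower of gerbes, in a typical fibre: $X_0$ is a point, $P_i$ is a principal $G_i$-bundle over $X_{i-1}$, $X_i=P_i\times_{G_i}F_i$, and for $i\ge 2$ the quotient $P_i/H_i$ is identified with the bundle $R_i=P_{i-1}\times_{G_{i-1}}p_{K_i}$ on $X_{i-1}$ induced by $p_{K_i}$. Since $H_i$ is central, a smooth function $V\times X_{i-1}\to H_i$, with $V\subset B$ open, acts on $V\times X_i$ and on $V\times R_{i+1}$. Suppose given, for all $i\ge1$, short exact sequences of sheaves of commutative groups on $B$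 $$1\to A_{i+1}\to E_i\to A_i\to 1,$$ where $A_1$ is the sheaf of all smooth $H_1$-valued functions; $E_i(V)$ consists of pairs of some $\varphi\in A_i(V)$ and a smooth family $\psi$, parametrized by $V$, of automorphisms of the principal bundle $P_{i+1}$ that induces the action of $\varphi$ on $R_{i+1}$; the map $E_i\to A_i$ is $(\varphi,\psi)\mapsto\varphi$; and $A_{i+1}(V)$ is the group of those smooth functions $V\times X_i\to H_{i+1}$ whose action on $P_{i+1}$ belongs to $E_i(V)$. **The classifying cocycles.** If $k_{xy}$ are transition functions of $p_{K_1}$ on an open covering of $B$ and $g_{xy}$ are smooth lifts of them to $G_1$, then $c_{H_1}=(g_{xy}g_{yz}g_{xz}^{-1})$ is a classifying $2$-cochain of the first lifting problem. If $c_{H_{n-1}}$ is a classifying $n$-cochain of the $(n-1)$-lifting problem and $t$ is a Čech $n$-cochain of $E_{n-1}$ with image $c_{H_{n-1}}$ in $A_{n-1}$, then the $A_n$-valued $(n+1)$-cochain $c_{H_n}$ whose action on $P_n$ is the Čech boundary $dt$ is a classifying cochain of the $n$-lifting problem. **Proposition 4.** Let $n\ge 2$. Classifying cochains of the $(n-1)$-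 and of the $n$-lifting problem exist and are cocycles; the sequence $1\to A_n\to E_{n-1}\to A_{n-1}\to 1$ has a unique connecting homomorphism $$\delta_n:\check H^n(B,A_{n-1})\to\check H^{n+1}(B,A_n)$$ (a homomorphism such that $\delta_n[s]=[a]$ whenever a cocycle $s$ is the image of a cochain $t$ of $E_{n-1}$ on the same covering and the cocycle $a$ maps to $dt$); and $$\delta_n[c_{H_{n-1}}]=[c_{H_n}]$$ for all classifying cocycles $c_{H_{n-1}}$ and $c_{H_n}$, whatever the coverings, lifts and lower cocycles from which each of them was formed. -/

import Mathlib

open scoped Manifold ContDiff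
open TopologicalSpace CategoryTheory Opposite

/-! ### Manifolds, Lie groups, principal bundles, associated bundles -/

/-- A smooth manifold: finite-dimensional, without boundary, Hausdorff, second countable. -/
structure Mfd where
  carrier : Type
  dim : ℕ
  [top : TopologicalSpace carrier]
  [charts : ChartedSpace (EuclideanSpace ℝ (Fin dim)) carrier]
  [smooth : IsManifold (𝓡 dim) ∞ carrier]
  [t2 : T2Space carrier]
  [sc : SecondCountableTopology carrier]

instance : CoeSort Mfd Type := ⟨Mfd.carrier⟩

attribute [instance] Mfd.top Mfd.charts Mfd.smooth Mfd.t2 Mfd.sc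

/-- The model with corners of a manifold. -/
noncomputable abbrev Mfd.I (X : Mfd) : ModelWithCorners ℝ (EuclideanSpace ℝ (Fin X.dim))
    (EuclideanSpace ℝ (Fin X.dim)) := 𝓡 X.dim

/-- A (finite-dimensional, real) Lie group. -/
structure LieGrp extends Mfd where
  [group : Group carrier]
  [lie : LieGroup (𝓡 dim) ∞ carrier]

instance : CoeSort LieGrp Type := ⟨fun G => G.toMfd.carrier⟩

instance (G : LieGrp) : Group G.toMfd := G.group
instance (G : LieGrp) : LieGroup (𝓡 G.dim) ∞ G.toMfd := G.lie

/-- A central extension `1 → H → G → K → 1` of Lie groups such that `G → K` has smooth local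
sections.  The central subgroup `H` is the kernel of `proj`, and `K` is the quotient `G / H`. -/
structure CentralExt where
  G : LieGrp
  K : LieGrp
  proj : G →* K
  smooth_proj : ContMDiff G.I K.I ∞ proj
  local_sections : ∀ k : K, ∃ W : Opens K.toMfd, k ∈ W ∧
    ∃ s : K → G, ContMDiffOn K.I G.I ∞ s W ∧ ∀ w ∈ W, proj (s w) = w
  central : proj.ker ≤ Subgroup.center G

/-- A smooth left action of a Lie group on a manifold. -/
structure SmoothAction (G : LieGrp) (F : Mfd) where
  act : G →* Equiv.Perm F
  smooth_act : ContMDiff (G.I.prod F.I) F.I ∞ (fun p : G × F => act p.1 p.2)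

/-- A smooth locally trivial principal bundle over `X` with structure group `G`, which acts on the
right; `P` is the total space. -/
structure PrincipalBundle (X : Mfd) (G : LieGrp) where
  P : Mfd
  π : P → X
  /-- `mul b g` is `b · g`. -/
  mul : P → G → P
  mul_one : ∀ b, mul b 1 = b
  mul_mul : ∀ b g h, mul b (g * h) = mul (mul b g) h
  π_mul : ∀ b g, π (mul b g) = π b
  smooth_π : ContMDiff P.I X.I ∞ π
  smooth_mul : ContMDiff (P.I.prod G.I) P.I ∞ (fun p : P × G => mul p.1 p.2)
  /-- Near every point there are a section `s` and a smooth map `d` such that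
  `b ↦ (π b, d b)` and `(x, g) ↦ s x · g` are inverse to each other. -/
  locally_trivial : ∀ x : X, ∃ W : Opens X, x ∈ W ∧ ∃ (s : X → P) (d : P → G),
    ContMDiffOn X.I P.I ∞ s W ∧ ContMDiffOn P.I G.I ∞ d (π ⁻¹' W) ∧
    (∀ w ∈ W, π (s w) = w) ∧ (∀ b, π b ∈ W → mul (s (π b)) (d b) = b) ∧
    (∀ w ∈ W, ∀ g, d (mul (s w) g) = g)

/-- `E`, with `ρ : P × Y → E`, is the bundle `P ×_G Y` with typical fibre `Y` associated to the
principal bundle `P`.  In other words, `E` is a locally trivial bundle with typical fibre `Y` whose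
transition functions take their values in `G`, and `ρ b : Y → E` is the
diffeomorphism onto a fibre that is given by the frame `b`. -/
structure AssocBundle {X : Mfd} {G : LieGrp} (P : PrincipalBundle X G) {Y : Mfd}
    (a : SmoothAction G Y) (E : Mfd) where
  ρ : P.P → Y → E
  π : E → X
  smooth_ρ : ContMDiff (P.P.I.prod Y.I) E.I ∞ (fun p : P.P × Y => ρ p.1 p.2)
  smooth_π : ContMDiff E.I X.I ∞ π
  π_ρ : ∀ b y, π (ρ b y) = P.π b
  ρ_mul : ∀ b g y, ρ (P.mul b g) y = ρ b (a.act g y)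
  ρ_injective : ∀ b, Function.Injective (ρ b)
  /-- Near every point there are a section `s` of `P` and a smooth map `η` such that
  `z ↦ (π z, η z)` and `(x, y) ↦ ρ (s x) y` are inverse to each other. -/
  locally_trivial : ∀ x : X, ∃ W : Opens X, x ∈ W ∧ ∃ (s : X → P.P) (η : E → Y),
    ContMDiffOn X.I P.P.I ∞ s W ∧ ContMDiffOn E.I Y.I ∞ η (π ⁻¹' W) ∧
    (∀ w ∈ W, P.π (s w) = w) ∧ (∀ z, π z ∈ W → ρ (s (π z)) (η z) = z)

/-! ### Čech cohomology of a presheaf of commutative groups (written multiplicatively) -/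

namespace Cech

variable {B : Type} [TopologicalSpace B]

/-- An open covering of `B` indexed by the points of `B`, the point `x` lying in the set with
index `x`.  These coverings are cofinal among all open coverings. -/
structure Cover (B : Type) [TopologicalSpace B] where
  U : B → Opens B
  mem : ∀ x, x ∈ U x

/-- `𝒰 ≤ 𝒱` means that `𝒱` is finer than `𝒰`. -/
instance : Preorder (Cover B) where
  le 𝒰 𝒱 := ∀ x, 𝒱.U x ≤ 𝒰.U x
  le_refl _ _ := le_rfl
  le_trans _ _ _ h h' x := (h' x).trans (h x)

instance : IsDirectedOrder (Cover B) where
  directed 𝒰 𝒱 := ⟨⟨fun x => 𝒰.U x ⊓ 𝒱.U x, fun x => ⟨𝒰.mem x, 𝒱.mem x⟩⟩,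
    fun _ => inf_le_left, fun _ => inf_le_right⟩

instance : Nonempty (Cover B) := ⟨⟨fun _ => ⊤, fun _ => trivial⟩⟩

/-- The intersection `U_{σ 0} ∩ … ∩ U_{σ p}`. -/
def Cover.inter (𝒰 : Cover B) {p : ℕ} (σ : Fin (p + 1) → B) : Opens B := ⨅ k, 𝒰.U (σ k)

theorem Cover.inter_le (𝒰 : Cover B) {p : ℕ} (σ : Fin (p + 1) → B) (k : Fin (p + 1)) :
    𝒰.inter σ ≤ 𝒰.U (σ k) := iInf_le _ k

theorem Cover.inter_face (𝒰 : Cover B) {p : ℕ} (σ : Fin (p + 2) → B) (j : Fin (p + 2)) :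
    𝒰.inter σ ≤ 𝒰.inter (σ ∘ j.succAbove) := le_iInf fun k => iInf_le _ (j.succAbove k)

theorem Cover.inter_mono {𝒰 𝒱 : Cover B} (h : 𝒰 ≤ 𝒱) {p : ℕ} (σ : Fin (p + 1) → B) :
    𝒱.inter σ ≤ 𝒰.inter σ := iInf_mono fun k => h (σ k)

/-- Presheaves of commutative groups on `B`. -/
abbrev Psh (B : Type) [TopologicalSpace B] := (Opens B)ᵒᵖ ⥤ CommGrpCat.{0}

/-- Sections of a presheaf over an open set. -/
abbrev Psh.sec (S : Psh B) (V : Opens B) : Type := S.obj (op V)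

/-- Restriction of sections. -/
abbrev Psh.res (S : Psh B) {V W : Opens B} (h : W ≤ V) : S.sec V →* S.sec W :=
  (S.map (homOfLE h).op).hom

theorem Psh.res_self (S : Psh B) {V : Opens B} (s : S.sec V) : S.res (le_refl V) s = s := by
  simp [Psh.res]

theorem Psh.res_res (S : Psh B) {V W W' : Opens B} (h : W ≤ V) (h' : W' ≤ W) (s : S.sec V) :
    S.res h' (S.res h s) = S.res (h'.trans h) s := by
  have e : (homOfLE (h'.trans h)).op = (homOfLE h).op ≫ (homOfLE h').op := rfl
  simp [Psh.res, e]

/-- Čech `p`-cochains on the covering `𝒰`. -/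
abbrev Cochain (S : Psh B) (𝒰 : Cover B) (p : ℕ) : Type :=
  ∀ σ : Fin (p + 1) → B, S.sec (𝒰.inter σ)

/-- The Čech differential `(d c)_σ = ∏_j (c_{σ ∘ δ_j})^{(-1)^j}`. -/
def d (S : Psh B) (𝒰 : Cover B) (p : ℕ) : Cochain S 𝒰 p →* Cochain S 𝒰 (p + 1) where
  toFun c σ := ∏ j : Fin (p + 2),
    (S.res (𝒰.inter_face σ j) (c (σ ∘ j.succAbove))) ^ ((-1 : ℤ) ^ (j : ℕ))
  map_one' := by funext σ; simp
  map_mul' c c' := by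
    funext σ
    simp only [Pi.mul_apply, map_mul, mul_zpow, Finset.prod_mul_distrib]

/-- Restriction of cochains to a finer covering. -/
def refine (S : Psh B) {𝒰 𝒱 : Cover B} (h : 𝒰 ≤ 𝒱) (p : ℕ) :
    Cochain S 𝒰 p →* Cochain S 𝒱 p where
  toFun c σ := S.res (Cover.inter_mono h σ) (c σ)
  map_one' := by funext σ; simp
  map_mul' c c' := by funext σ; simp

theorem d_refine (S : Psh B) {𝒰 𝒱 : Cover B} (h : 𝒰 ≤ 𝒱) (p : ℕ) (c : Cochain S 𝒰 p) :
    d S 𝒱 p (refine S h p c) = refine S h (p + 1) (d S 𝒰 p c) := by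
  funext σ
  simp only [d, refine, MonoidHom.coe_mk, OneHom.coe_mk, map_prod, map_zpow, Psh.res_res]

/-- Čech `p`-cocycles on the covering `𝒰`. -/
def Z (S : Psh B) (𝒰 : Cover B) (p : ℕ) : Subgroup (Cochain S 𝒰 p) := (d S 𝒰 p).ker

/-- Čech `p`-coboundaries on the covering `𝒰`. -/
def bd (S : Psh B) (𝒰 : Cover B) : (p : ℕ) → Subgroup (Cochain S 𝒰 p)
  | 0 => ⊥
  | p + 1 => (d S 𝒰 p).range

/-- The cohomology group `H^p(𝒰, S)`. -/
abbrev HCover (S : Psh B) (p : ℕ) (𝒰 : Cover B) : Type :=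
  Z S 𝒰 p ⧸ (bd S 𝒰 p).subgroupOf (Z S 𝒰 p)

/-- Restriction of cocycles to a finer covering. -/
def refineZ (S : Psh B) {𝒰 𝒱 : Cover B} (h : 𝒰 ≤ 𝒱) (p : ℕ) : Z S 𝒰 p →* Z S 𝒱 p :=
  ((refine S h p).comp (Z S 𝒰 p).subtype).codRestrict _ fun c => by
    have hc : d S 𝒰 p c = 1 := c.2
    show d S 𝒱 p (refine S h p c) = 1
    rw [d_refine, hc, map_one]

theorem refine_bd (S : Psh B) {𝒰 𝒱 : Cover B} (h : 𝒰 ≤ 𝒱) (p : ℕ) (c : Cochain S 𝒰 p)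
    (hc : c ∈ bd S 𝒰 p) : refine S h p c ∈ bd S 𝒱 p := by
  cases p with
  | zero =>
    have hc' : c = 1 := hc
    rw [hc', map_one]
    exact one_mem _
  | succ p =>
    obtain ⟨b, rfl⟩ := hc
    exact ⟨refine S h p b, d_refine S h p b⟩

/-- The map `H^p(𝒰, S) → H^p(𝒱, S)` for a finer covering `𝒱`. -/
def trans (S : Psh B) (p : ℕ) (𝒰 𝒱 : Cover B) (h : 𝒰 ≤ 𝒱) : HCover S p 𝒰 →* HCover S p 𝒱 :=
  QuotientGroup.map _ _ (refineZ S h p) fun c hc => refine_bd S h p c hc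

instance (S : Psh B) (p : ℕ) :
    DirectedSystem (HCover S p) (fun 𝒰 𝒱 h => (trans S p 𝒰 𝒱 h : HCover S p 𝒰 → HCover S p 𝒱)) where
  map_self 𝒰 x := by
    induction x using QuotientGroup.induction_on with
    | H c =>
      refine congrArg _ (Subtype.ext ?_)
      funext σ
      exact S.res_self _
  map_map 𝒲 𝒱 𝒰 h h' x := by
    induction x using QuotientGroup.induction_on with
    | H c =>
      refine congrArg _ (Subtype.ext ?_)
      funext σ
      exact S.res_res _ _ _

/-- Čech cohomology `Ȟ^p(B, S)`: the direct limit of `H^p(𝒰, S)` over the coverings `𝒰`. -/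
abbrev H (S : Psh B) (p : ℕ) : Type := DirectLimit (HCover S p) (trans S p)

/-- The class in `Ȟ^p(B, S)` of a cocycle on the covering `𝒰`. -/
def cls {S : Psh B} {p : ℕ} {𝒰 : Cover B} (c : Cochain S 𝒰 p) (hc : d S 𝒰 p c = 1) : H S p :=
  Quotient.mk _ ⟨𝒰, QuotientGroup.mk ⟨c, hc⟩⟩

/-- The map on cochains induced by a morphism of presheaves. -/
def mapCochain {S T : Psh B} (f : S ⟶ T) {𝒰 : Cover B} {p : ℕ} (c : Cochain S 𝒰 p) :
    Cochain T 𝒰 p := fun σ => (f.app (op (𝒰.inter σ))).hom (c σ)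

/-- `δ : Ȟ^p(B, S₃) → Ȟ^{p+1}(B, S₁)` is the connecting homomorphism of the short exact sequence
`S₁ → S₂ → S₃`: whenever a cocycle `s` of `S₃` on some covering is the image of a cochain `t` of
`S₂`, and `d t` is the image of a cocycle `a` of `S₁`, then `δ [s] = [a]`. -/
def IsConnecting {S₁ S₂ S₃ : Psh B} (ι : S₁ ⟶ S₂) (q : S₂ ⟶ S₃) (p : ℕ)
    (δ : H S₃ p →* H S₁ (p + 1)) : Prop :=
  ∀ (𝒰 : Cover B) (s : Cochain S₃ 𝒰 p) (hs : d S₃ 𝒰 p s = 1) (t : Cochain S₂ 𝒰 p)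
    (a : Cochain S₁ 𝒰 (p + 1)) (ha : d S₁ 𝒰 (p + 1) a = 1),
    mapCochain q t = s → mapCochain ι a = d S₂ 𝒰 p t → δ (cls s hs) = cls a ha

end Cech

/-! ### The lifting problem -/

/-- The data of the lifting problem: manifolds `F 0 = B, F 1, F 2, …`; Lie groups of
diffeomorphisms of `F (i + 1)` (the group `(ext i).G`) with central subgroups `ker (ext i).proj`
and quotients `(ext i).K`; and principal `(ext i).K`-bundles `pK i` over `F i`.  The group that
acts on `F (i + 1)` acts on `pK (i + 1)` above this action; this is what makes `pK (i + 1)` induce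
a bundle on every bundle with typical fibre `F (i + 1)` and group `(ext i).G`.
The `n`-lifting problem consists of the levels `0, …, n - 1`; a finite sequence is continued by
trivial groups and one-point fibres. -/
structure LiftingProblem where
  F : ℕ → Mfd
  ext : ℕ → CentralExt
  act : ∀ i, SmoothAction (ext i).G (F (i + 1))
  faithful : ∀ i, Function.Injective (act i).act
  pK : ∀ i, PrincipalBundle (F i) (ext i).K
  actK : ∀ i, SmoothAction (ext i).G (pK (i + 1)).P
  π_actK : ∀ i g y, (pK (i + 1)).π ((actK i).act g y) = (act i).act g ((pK (i + 1)).π y)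
  mul_actK : ∀ i g y k,
    (pK (i + 1)).mul ((actK i).act g y) k = (actK i).act g ((pK (i + 1)).mul y k)

/-- A sequence of objects of the tower of gerbes.  Over a small open set `V` of `B`, an object of the
first gerbe is `V × X 1` with `X 1 = F 1`, an object of the second gerbe over it is `V × X 2`, and so
on, where `X (i + 1) → X i` is a bundle with typical fibre `F (i + 1)` and principal
`(ext i).G`-bundle `P i`, and the quotient of `P (i + 1)` by the central subgroup is the bundle `R i`
on `X (i + 1)` induced by `pK (i + 1)`. -/
structure Tower (D : LiftingProblem) where
  X : ℕ → Mfd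
  point : Nonempty (Unique (X 0))
  P : ∀ i, PrincipalBundle (X i) (D.ext i).G
  e : ∀ i, AssocBundle (P i) (D.act i) (X (i + 1))
  /-- The principal `(D.ext (i + 1)).K`-bundle on `X (i + 1)` induced by `D.pK (i + 1)`. -/
  R : ℕ → Mfd
  r : ∀ i, AssocBundle (P i) (D.actK i) (R i)
  /-- The quotient map of `P (i + 1)` by the central subgroup. -/
  κ : ∀ i, (P (i + 1)).P → R i
  smooth_κ : ∀ i, ContMDiff (P (i + 1)).P.I (R i).I ∞ (κ i)
  /-- `κ` lies over the identity of `X (i + 1)`. -/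
  κ_over : ∀ i b q y, κ i b = (r i).ρ q y →
    (P (i + 1)).π b = (e i).ρ q ((D.pK (i + 1)).π y)
  /-- `κ` is equivariant along `G → K`. -/
  κ_mul : ∀ i b q y g, κ i b = (r i).ρ q y →
    κ i ((P (i + 1)).mul b g) = (r i).ρ q ((D.pK (i + 1)).mul y ((D.ext (i + 1)).proj g))

namespace Tower

variable {D : LiftingProblem} (T : Tower D)

/-- Maps `V × X i → G`, a group under pointwise multiplication. -/
abbrev Fn (i : ℕ) (V : Opens (D.F 0)) : Type := (V × T.X i) → (D.ext i).G

/-- Families of permutations of the total space of `P i` that are parametrized by `V`. -/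
abbrev Pm (i : ℕ) (V : Opens (D.F 0)) : Type := V → Equiv.Perm (T.P i).P

/-- Restriction of maps to a smaller open set. -/
def resFn (i : ℕ) {V W : Opens (D.F 0)} (h : W ≤ V) : T.Fn i V →* T.Fn i W where
  toFun f p := f (⟨p.1, h p.1.2⟩, p.2)
  map_one' := rfl
  map_mul' _ _ := rfl

/-- Restriction of families of permutations to a smaller open set. -/
def resPm (i : ℕ) {V W : Opens (D.F 0)} (h : W ≤ V) : T.Pm i V →* T.Pm i W where
  toFun f v := f ⟨v, h v.2⟩
  map_one' := rfl
  map_mul' _ _ := rfl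

/-- Smooth functions on `V × X i` with values in the central subgroup. -/
def IsHFn (i : ℕ) (V : Opens (D.F 0)) (f : T.Fn i V) : Prop :=
  ContMDiff ((D.F 0).I.prod (T.X i).I) (D.ext i).G.I ∞ f ∧ ∀ p, (D.ext i).proj (f p) = 1

/-- `ψ` is a smooth family of automorphisms of `P (i + 1)` that lies over the action of `φ` on the
induced bundle `R i` (hence over its action on `X (i + 1)`): `φ` takes its values in a central
subgroup and acts on the fibres of `X (i + 1) → X i` and of `R i → X i`. -/
def IsLift (i : ℕ) (V : Opens (D.F 0)) (φ : T.Fn i V) (ψ : T.Pm (i + 1) V) : Prop :=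
  ContMDiff ((D.F 0).I.prod (T.P (i + 1)).P.I) (T.P (i + 1)).P.I ∞
    (fun p : V × (T.P (i + 1)).P => ψ p.1 p.2) ∧
  ContMDiff ((D.F 0).I.prod (T.P (i + 1)).P.I) (T.P (i + 1)).P.I ∞
    (fun p : V × (T.P (i + 1)).P => (ψ p.1)⁻¹ p.2) ∧
  (∀ v b g, ψ v ((T.P (i + 1)).mul b g) = (T.P (i + 1)).mul (ψ v b) g) ∧
  ∀ v b q y, T.κ i b = (T.r i).ρ q y →
    T.κ i (ψ v b) = (T.r i).ρ q ((D.actK i).act (φ (v, (T.P i).π q)) y)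

/-- The family of permutations `b ↦ b · h (v, π b)` of `P i` given by a function `h`. -/
def vert (i : ℕ) (V : Opens (D.F 0)) (h : T.Fn i V) : T.Pm i V := fun v =>
  { toFun := fun b => (T.P i).mul b (h (v, (T.P i).π b))
    invFun := fun b => (T.P i).mul b (h (v, (T.P i).π b))⁻¹
    left_inv := fun b => by
      simp only [(T.P i).π_mul, ← (T.P i).mul_mul, mul_inv_cancel, (T.P i).mul_one]
    right_inv := fun b => by
      simp only [(T.P i).π_mul, ← (T.P i).mul_mul, inv_mul_cancel, (T.P i).mul_one] }

theorem vert_mul (i : ℕ) (V : Opens (D.F 0)) (h h' : T.Fn i V) (hh : T.IsHFn i V h) :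
    T.vert i V (h * h') = T.vert i V h * T.vert i V h' := by
  funext v
  ext b
  have hc := (D.ext i).central ((MonoidHom.mem_ker).2 (hh.2 (v, (T.P i).π b)))
  have := Subgroup.mem_center_iff.1 hc (h' (v, (T.P i).π b))
  simp only [vert, Pi.mul_apply, Equiv.coe_fn_mk, Equiv.Perm.coe_mul, Function.comp_apply,
    (T.P i).π_mul, ← (T.P i).mul_mul, this]

theorem vert_one (i : ℕ) (V : Opens (D.F 0)) : T.vert i V 1 = 1 := by
  funext v
  ext b
  simp [vert, (T.P i).mul_one]

/-- The short exact sequences of sheaves of commutative groups on `B` along which the classifying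
cocycles of the tower are formed.

* `A i` is a sheaf of functions with values in the central subgroup of level `i`; `A 0` consists of
  all smooth functions `V → H`.
* `E i` is a sheaf of automorphisms of `P (i + 1)` that lie over the action of the elements of `A i`;
  it is commutative, and every element of `A i` lifts locally to `E i`.
* `A (i + 1)` consists of the functions whose (vertical) action on `P (i + 1)` belongs to `E i`; it
  is the kernel of `E i → A i`. -/
structure Sheaves where
  A : ∀ i (V : Opens (D.F 0)), Subgroup (T.Fn i V)
  E : ∀ i (V : Opens (D.F 0)), Subgroup (T.Fn i V × T.Pm (i + 1) V)
  mem_A_zero : ∀ V f, f ∈ A 0 V ↔ T.IsHFn 0 V f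
  mem_A_succ : ∀ i V h, h ∈ A (i + 1) V ↔
    T.IsHFn (i + 1) V h ∧ ((1, T.vert (i + 1) V h) : T.Fn i V × T.Pm (i + 1) V) ∈ E i V
  lift_of_mem : ∀ i V x, x ∈ E i V → x.1 ∈ A i V ∧ T.IsLift i V x.1 x.2
  E_comm : ∀ i V, ∀ x ∈ E i V, ∀ y ∈ E i V, x * y = y * x
  E_res : ∀ i (V W : Opens (D.F 0)) (h : W ≤ V), ∀ x ∈ E i V,
    ((T.resFn i h x.1, T.resPm (i + 1) h x.2) : T.Fn i W × T.Pm (i + 1) W) ∈ E i W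
  E_local : ∀ i (V : Opens (D.F 0)) (x : T.Fn i V × T.Pm (i + 1) V),
    (∀ v ∈ V, ∃ (W : Opens (D.F 0)) (h : W ≤ V), v ∈ W ∧
      ((T.resFn i h x.1, T.resPm (i + 1) h x.2) : T.Fn i W × T.Pm (i + 1) W) ∈ E i W) → x ∈ E i V
  E_surjective : ∀ i (V : Opens (D.F 0)), ∀ f ∈ A i V, ∀ v ∈ V,
    ∃ (W : Opens (D.F 0)) (h : W ≤ V), v ∈ W ∧ ∃ ψ : T.Pm (i + 1) W,
      ((T.resFn i h f, ψ) : T.Fn i W × T.Pm (i + 1) W) ∈ E i W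

theorem isHFn_res {i : ℕ} {V W : Opens (D.F 0)} (h : W ≤ V) {f : T.Fn i V}
    (hf : T.IsHFn i V f) : T.IsHFn i W (T.resFn i h f) := by
  refine ⟨hf.1.comp ?_, fun p => hf.2 _⟩
  exact ((contMDiff_inclusion h).comp contMDiff_fst).prodMk contMDiff_snd

namespace Sheaves

variable {T} (S : T.Sheaves)

theorem isHFn_of_mem {i : ℕ} {V : Opens (D.F 0)} {f : T.Fn i V} (hf : f ∈ S.A i V) :
    T.IsHFn i V f := by
  cases i with
  | zero => exact (S.mem_A_zero V f).1 hf
  | succ i => exact ((S.mem_A_succ i V f).1 hf).1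

theorem A_res (i : ℕ) {V W : Opens (D.F 0)} (h : W ≤ V) (f : T.Fn i V) (hf : f ∈ S.A i V) :
    T.resFn i h f ∈ S.A i W := by
  cases i with
  | zero => exact (S.mem_A_zero _ _).2 (T.isHFn_res h (S.isHFn_of_mem hf))
  | succ i =>
    refine (S.mem_A_succ _ _ _).2 ⟨T.isHFn_res h (S.isHFn_of_mem hf), ?_⟩
    exact S.E_res i V W h _ ((S.mem_A_succ i V f).1 hf).2

instance (i : ℕ) (V : Opens (D.F 0)) : CommGroup (S.A i V) where
  mul_comm f g := by
    refine Subtype.ext (funext fun p => ?_)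
    have hc := (D.ext i).central ((MonoidHom.mem_ker).2 ((S.isHFn_of_mem g.2).2 p))
    exact Subgroup.mem_center_iff.1 hc (f.1 p)

instance (i : ℕ) (V : Opens (D.F 0)) : CommGroup (S.E i V) where
  mul_comm x y := Subtype.ext (S.E_comm i V x x.2 y y.2)

/-- `A i` as a presheaf of commutative groups. -/
def shA (i : ℕ) : Cech.Psh (D.F 0) where
  obj V := CommGrpCat.of (S.A i V.unop)
  map h := CommGrpCat.ofHom
    { toFun := fun f => ⟨T.resFn i (leOfHom h.unop) f.1, S.A_res i _ f.1 f.2⟩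
      map_one' := rfl
      map_mul' := fun _ _ => rfl }
  map_id _ := rfl
  map_comp _ _ := rfl

/-- `E i` as a presheaf of commutative groups. -/
def shE (i : ℕ) : Cech.Psh (D.F 0) where
  obj V := CommGrpCat.of (S.E i V.unop)
  map h := CommGrpCat.ofHom
    { toFun := fun x => ⟨(T.resFn i (leOfHom h.unop) x.1.1, T.resPm (i + 1) (leOfHom h.unop) x.1.2),
        S.E_res i _ _ _ x.1 x.2⟩
      map_one' := rfl
      map_mul' := fun _ _ => rfl }
  map_id _ := rfl
  map_comp _ _ := rfl

/-- The inclusion `A (i + 1) → E i`, `h ↦ (b ↦ b · h (v, π b))`. -/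
def incl (i : ℕ) : S.shA (i + 1) ⟶ S.shE i where
  app _ := CommGrpCat.ofHom
    { toFun := fun h => ⟨(1, T.vert (i + 1) _ h.1), ((S.mem_A_succ i _ h.1).1 h.2).2⟩
      map_one' := Subtype.ext (Prod.ext rfl (T.vert_one _ _))
      map_mul' := fun h h' => Subtype.ext
        (Prod.ext (mul_one 1).symm (T.vert_mul _ _ h.1 h'.1 (S.isHFn_of_mem h.2))) }
  naturality _ _ _ := rfl

/-- The projection `E i → A i` that sends an automorphism to the function which it lies over. -/
def toA (i : ℕ) : S.shE i ⟶ S.shA i where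
  app _ := CommGrpCat.ofHom
    { toFun := fun x => ⟨x.1.1, (S.lift_of_mem i _ x.1 x.2).1⟩
      map_one' := rfl
      map_mul' := fun _ _ => rfl }
  naturality _ _ _ := rfl

/-- `c` is a classifying 2-cocycle of the first lifting problem on the covering `𝒰`:
`s x` are local sections of the principal bundle `pK 0` over `B`, `k x y` are its transition
functions, `g x y` are smooth lifts of these to `G`, and `c x y z = g x y · g y z · (g x z)⁻¹`. -/
def IsClassifyingFirst (𝒰 : Cech.Cover (D.F 0)) (c : Cech.Cochain (S.shA 0) 𝒰 2) : Prop :=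
  ∃ (s : ∀ x, 𝒰.U x → (D.pK 0).P)
    (k : ∀ x y, (𝒰.U x ⊓ 𝒰.U y : Opens (D.F 0)) → (D.ext 0).K)
    (g : ∀ x y, (𝒰.U x ⊓ 𝒰.U y : Opens (D.F 0)) → (D.ext 0).G),
    (∀ x, ContMDiff (D.F 0).I (D.pK 0).P.I ∞ (s x)) ∧
    (∀ x (v : 𝒰.U x), (D.pK 0).π (s x v) = v) ∧
    (∀ x y (v : (𝒰.U x ⊓ 𝒰.U y : Opens (D.F 0))),
      s y ⟨v, v.2.2⟩ = (D.pK 0).mul (s x ⟨v, v.2.1⟩) (k x y v)) ∧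
    (∀ x y, ContMDiff (D.F 0).I (D.ext 0).G.I ∞ (g x y)) ∧
    (∀ x y v, (D.ext 0).proj (g x y v) = k x y v) ∧
    ∀ (σ : Fin 3 → D.F 0) (v : (𝒰.inter σ : Opens (D.F 0))) (a : T.X 0),
      (c σ).1 (v, a) =
        g (σ 0) (σ 1) ⟨v, 𝒰.inter_le σ 0 v.2, 𝒰.inter_le σ 1 v.2⟩ *
        g (σ 1) (σ 2) ⟨v, 𝒰.inter_le σ 1 v.2, 𝒰.inter_le σ 2 v.2⟩ *
        (g (σ 0) (σ 2) ⟨v, 𝒰.inter_le σ 0 v.2, 𝒰.inter_le σ 2 v.2⟩)⁻¹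

/-- `S.IsClassifying i 𝒰 c`: the `A i`-valued `(i + 2)`-cochain `c` is a classifying cocycle of the
`(i + 1)`-lifting problem on the covering `𝒰`.  At the first level it is formed from lifts of the
transition functions of `pK 0`.  At level `i + 1`, choose a classifying cocycle `c'` of
level `i` and automorphisms `t` of the objects of the next gerbe that lie over the action of `c'`; the
Čech boundary of `t` is the action of an `H`-valued function, and this is `c`. -/
def IsClassifying : (i : ℕ) → (𝒰 : Cech.Cover (D.F 0)) → Cech.Cochain (S.shA i) 𝒰 (i + 2) → Prop
  | 0, 𝒰, c => S.IsClassifyingFirst 𝒰 c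
  | i + 1, 𝒰, c => ∃ (c' : Cech.Cochain (S.shA i) 𝒰 (i + 2)) (t : Cech.Cochain (S.shE i) 𝒰 (i + 2)),
      IsClassifying i 𝒰 c' ∧
      (∀ σ, ((t σ).1.1 : T.Fn i (𝒰.inter σ)) = (c' σ).1) ∧
      ∀ σ, T.vert (i + 1) (𝒰.inter σ) (c σ).1 = (Cech.d (S.shE i) 𝒰 (i + 2) t σ).1.2

end Sheaves

end Tower

/-! Forming a classifying cocycle of the next level is the snake construction for `A (i + 1) → E i →
A i`: lift a cocycle of `A i` to `E i` and take the boundary of the lift. So once the connecting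
homomorphism `δ` exists, it sends the class of the particular lower cocycle used to the class of the
result (`IsClassifying.exists_connecting`). The remaining content is that choices do not matter.

Exactness in the middle is geometric: an automorphism of the principal bundle that induces the
identity on the quotient by the central subgroup is multiplication by a unique smooth central-valued
function (`IsLift.exists_vert`). Surjectivity onto `A i` is only local, but `B` is paracompact, so
every cochain lifts after refinement (`Cover.exists_refine`). This refinement changes indices by a
map `τ`; a prism homotopy shows that reindexing does not affect cohomology classes in positive
degree (`cls_pull`). The usual argument then gives a unique `δ` (`existsUnique_connecting`).

Independence of choices is an induction on the level (`IsClassifying.cls_eq`). At the first level,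
two systems of sections and lifts are compared directly and the cocycles differ by a coboundary. At
a higher level, both classes are images under the same `δ` of lower classes, which agree by
induction. Existence uses the same lifting after refinement, because classifying cochains can be
pulled back along `τ`. -/

namespace Cech

/-! ### Cochains on a full simplex and the prism homotopy. -/

section Combinatorics

variable {I J M : Type*} [CommGroup M]

/-- The differential of the cochain complex of functions on the full simplex with vertices `I`. -/
def simplexD {p : ℕ} (f : (Fin p → I) → M) (σ : Fin (p + 1) → I) : M :=
  ∏ j : Fin (p + 1), f (σ ∘ j.succAbove) ^ ((-1 : ℤ) ^ (j : ℕ))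

/-- The tuple `α (σ 0), …, α (σ k), β (σ k), …, β (σ p)`. -/
def prism (α β : J → I) {p : ℕ} (k : Fin p) (σ : Fin p → J) (j : Fin (p + 1)) : I :=
  if j ≤ k.castSucc then α (σ (k.predAbove j)) else β (σ (k.predAbove j))

/-- The homotopy between the maps induced by two maps of vertices. -/
def simplexHomotopy (α β : J → I) {p : ℕ} (f : (Fin (p + 1) → I) → M) (σ : Fin p → J) : M :=
  ∏ k : Fin p, f (prism α β k σ) ^ ((-1 : ℤ) ^ (k : ℕ))

/-- The face omitting `x` gives the numerator; every other face keeps `x` and has its sign shifted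
by one. This cone formula drives the inductions on the number of vertices. -/
theorem simplexD_cons {p : ℕ} (f : (Fin (p + 1) → I) → M) (x : I) (σ : Fin (p + 1) → I) :
    simplexD f (Fin.cons x σ : Fin (p + 2) → I) =
      f σ / simplexD (fun ρ => f (Fin.cons x ρ)) σ := by
  have h (j : Fin (p + 1)) : (Fin.cons x σ : Fin (p + 2) → I) ∘ j.succ.succAbove =
      Fin.cons x (σ ∘ j.succAbove) := by
    funext i
    cases i using Fin.cases with
    | zero => simp
    | succ i => simp
  have h0 : (Fin.cons x σ : Fin (p + 2) → I) ∘ Fin.succAbove 0 = σ := by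
    funext i; simp
  rw [simplexD, Fin.prod_univ_succ, h0, simplexD, div_eq_mul_inv, ← Finset.prod_inv_distrib]
  simp [h, pow_succ]

theorem simplexD_div {p : ℕ} (f g : (Fin p → I) → M) (σ : Fin (p + 1) → I) :
    simplexD (fun ρ => f ρ / g ρ) σ = simplexD f σ / simplexD g σ := by
  simp [simplexD, div_zpow]

theorem simplexHomotopy_div (α β : J → I) {p : ℕ} (f g : (Fin (p + 1) → I) → M)
    (σ : Fin p → J) :
    simplexHomotopy α β (fun ρ => f ρ / g ρ) σ =
      simplexHomotopy α β f σ / simplexHomotopy α β g σ := by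
  simp [simplexHomotopy, div_zpow]

theorem simplexD_simplexD : ∀ {p : ℕ} (f : (Fin p → I) → M) (σ : Fin (p + 2) → I),
    simplexD (simplexD f) σ = 1
  | 0, f, σ => by
    -- The complex is augmented: a function of the empty tuple is a constant, and its two
    -- contributions cancel.
    have h (ρ : Fin 0 → I) : f ρ = f default := congrArg f (Subsingleton.elim _ _)
    simp [simplexD, h, Fin.prod_univ_two]
  | p + 1, f, σ => by
    obtain ⟨x, σ, rfl⟩ : ∃ x ρ, σ = Fin.cons x ρ := ⟨_, _, (Fin.cons_self_tail σ).symm⟩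
    simp only [simplexD_cons, simplexD_div]
    rw [simplexD_simplexD (fun ρ => f (Fin.cons x ρ)) σ]
    simp

/-- Only the prism with `k = 0` switches from `α` to `β` at `x`; all the others start with `α x` and
continue as prisms over `σ`. -/
theorem simplexHomotopy_cons (α β : J → I) {p : ℕ} (f : (Fin (p + 2) → I) → M) (x : J)
    (σ : Fin p → J) :
    simplexHomotopy α β f (Fin.cons x σ : Fin (p + 1) → J) =
      f (Fin.cons (α x) (Fin.cons (β x) (β ∘ σ) : Fin (p + 1) → I)) /
        simplexHomotopy α β (fun ρ => f (Fin.cons (α x) ρ)) σ := by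
  have h (k : Fin p) : prism α β k.succ (Fin.cons x σ : Fin (p + 1) → J) =
      Fin.cons (α x) (prism α β k σ) := by
    funext i
    cases i using Fin.cases with
    | zero => simp [prism]
    | succ i => simp [prism, Fin.succ_predAbove_succ, ← Fin.succ_castSucc, -Fin.castSucc_succ]
  have h0 : prism α β 0 (Fin.cons x σ : Fin (p + 1) → J) =
      Fin.cons (α x) (Fin.cons (β x) (β ∘ σ) : Fin (p + 1) → I) := by
    funext i
    cases i using Fin.cases with
    | zero => simp [prism]
    | succ i =>
      cases i using Fin.cases with
      | zero => simp [prism]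
      | succ i => simp [prism]
  rw [simplexHomotopy, Fin.prod_univ_succ, h0, simplexHomotopy, div_eq_mul_inv,
    ← Finset.prod_inv_distrib]
  simp [h, pow_succ]

theorem comp_cons (β : J → I) {p : ℕ} (x : J) (σ : Fin p → J) :
    β ∘ (Fin.cons x σ : Fin (p + 1) → J) = Fin.cons (β x) (β ∘ σ) := by
  funext i
  cases i using Fin.cases <;> simp

theorem simplexHomotopy_spec (α β : J → I) : ∀ {p : ℕ} (f : (Fin (p + 1) → I) → M)
    (σ : Fin (p + 1) → J),
    simplexD (simplexHomotopy α β f) σ * simplexHomotopy α β (simplexD f) σ =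
      f (β ∘ σ) / f (α ∘ σ)
  | 0, f, σ => by
    obtain ⟨x, σ, rfl⟩ : ∃ x ρ, σ = Fin.cons x ρ := ⟨_, _, (Fin.cons_self_tail σ).symm⟩
    have h (ρ : Fin 0 → I) : ρ = default := Subsingleton.elim _ _
    rw [simplexHomotopy_cons, simplexD_cons, comp_cons, comp_cons]
    simp [simplexHomotopy, simplexD, h]
  | p + 1, f, σ => by
    obtain ⟨x, σ, rfl⟩ : ∃ x ρ, σ = Fin.cons x ρ := ⟨_, _, (Fin.cons_self_tail σ).symm⟩
    have ih := simplexHomotopy_spec α β (fun ρ => f (Fin.cons (α x) ρ)) σ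
    -- The differential is natural in the vertices, so `β` may be moved outside; the remaining terms
    -- then cancel formally.
    have hn : simplexD (fun ρ : Fin p → J =>
        f (Fin.cons (α x) (Fin.cons (β x) (β ∘ ρ) : Fin (p + 1) → I))) σ =
        simplexD (fun ρ : Fin p → I =>
        f (Fin.cons (α x) (Fin.cons (β x) ρ : Fin (p + 1) → I))) (β ∘ σ) := rfl
    rw [comp_cons, comp_cons, simplexD_cons, simplexHomotopy_cons, simplexD_cons, simplexD_cons]
    simp only [simplexHomotopy_cons, simplexD_div, simplexD_cons, simplexHomotopy_div]
    rw [hn]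
    rw [eq_div_iff_mul_eq'] at ih
    rw [← ih]
    apply Additive.ofMul.injective
    simp only [ofMul_mul, ofMul_div]
    abel

end Combinatorics

/-! ### Refinements adapted to a local property of simplices. -/

/-- Every local property of the simplices of a covering of a paracompact space holds for the
simplices of some refinement. -/
theorem Cover.exists_refine {B : Type} [TopologicalSpace B] [T2Space B] [ParacompactSpace B]
    (𝒰 : Cover B) {p : ℕ} (Q : (Fin (p + 1) → B) → Opens B → Prop)
    (mono : ∀ σ V W, W ≤ V → Q σ V → Q σ W) (bot : ∀ σ, Q σ ⊥)
    (loc : ∀ σ, ∀ v ∈ 𝒰.inter σ, ∃ W, v ∈ W ∧ Q σ W) :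
    ∃ (𝒱 : Cover B) (_ : 𝒰 ≤ 𝒱) (τ : B → B), (∀ x, 𝒱.U x ≤ 𝒰.U (τ x)) ∧
      ∀ σ, Q (τ ∘ σ) (𝒱.inter σ) := by
  classical
  obtain ⟨w, wo, wU, wf, wu⟩ := precise_refinement (fun x => (𝒰.U x : Set B))
    (fun x => (𝒰.U x).2) (Set.iUnion_eq_univ_iff.2 fun x => ⟨x, 𝒰.mem x⟩)
  obtain ⟨w', wU', wo', wc'⟩ := exists_iUnion_eq_closure_subset wo (fun x => wf.point_finite x) wU
  have hτ (x : B) : ∃ b, x ∈ w' b := Set.iUnion_eq_univ_iff.1 wU' x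
  choose τ hτ using hτ
  have hcl (x : B) : IsClosed (⋃ b : {b // x ∉ w b}, closure (w' b)) :=
    ((wf.subset wc').comp_injective Subtype.val_injective).isClosed_iUnion
      fun _ => isClosed_closure
  -- Point-finiteness leaves finitely many simplices `ρ` to consider at `x`, so one neighbourhood
  -- serves all of them.
  have hO (x : B) : ∃ O : Opens B, x ∈ O ∧ ∀ ρ : Fin (p + 1) → B, (∀ k, x ∈ w (ρ k)) → Q ρ O := by
    have : Finite {b | x ∈ w b} := wf.point_finite x
    have h (ρ : Fin (p + 1) → {b | x ∈ w b}) : ∃ W : Opens B, x ∈ W ∧ Q (fun k => ρ k) W :=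
      loc _ x (by
        rw [Cover.inter, ← SetLike.mem_coe, Opens.coe_iInf, Set.mem_iInter]
        exact fun k => wu _ (ρ k).2)
    choose W hW hQ using h
    refine ⟨⨅ ρ, W ρ, ?_, fun ρ hρ => mono _ _ _ (iInf_le _ _) (hQ fun k => ⟨ρ k, hρ k⟩)⟩
    rw [← SetLike.mem_coe, Opens.coe_iInf]
    exact Set.mem_iInter.2 hW
  choose O hxO hO using hO
  -- The set at `x` avoids every closed `closure (w' b)` with `x ∉ w b`; hence if it meets `w' b`,
  -- then `x ∈ w b`. Their union is closed by local finiteness.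
  refine ⟨⟨fun x => (𝒰.U x ⊓ ⟨w' (τ x), wo' _⟩) ⊓ (⟨_, (hcl x).isOpen_compl⟩ ⊓ O x),
    fun x => ⟨⟨𝒰.mem x, hτ x⟩, ?_, hxO x⟩⟩, fun x => inf_le_left.trans inf_le_left, τ, ?_, ?_⟩
  · rintro ⟨_, ⟨⟨b, hb⟩, rfl⟩, h⟩
    exact hb (wc' b h)
  · exact fun x => inf_le_left.trans (inf_le_right.trans fun v hv => wu _ (wc' _ (subset_closure hv)))
  · intro σ
    set V := Cover.inter _ σ with hV
    by_cases hne : V = ⊥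
    · rw [hne]; exact bot _
    obtain ⟨v, hv⟩ : ∃ v, v ∈ V := by
      by_contra! h
      exact hne (le_bot_iff.1 fun v hv => (h v hv).elim)
    have hk (k) := Cover.inter_le _ σ k hv
    -- A common point `v` lies in each `w' (τ (σ k))`, which forces `σ 0 ∈ w (τ (σ k))`. So `O (σ
    -- 0)` works for the whole simplex `τ ∘ σ`.
    refine mono _ _ _ ((Cover.inter_le _ σ 0).trans (inf_le_right.trans inf_le_right))
      (hO (σ 0) _ fun k => ?_)
    by_contra h
    exact (hk 0).2.1 (Set.mem_iUnion.2 ⟨⟨_, h⟩, subset_closure (hk k).1.2⟩)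

end Cech

/-! ### Reindexing of cochains, and classes in the direct limit. -/

namespace Cech

variable {B : Type} [TopologicalSpace B]

section Pull

variable (S : Psh B) {𝒰 𝒱 : Cover B}

theorem Cover.le_inter {V : Opens B} {p : ℕ} {σ : Fin (p + 1) → B} (h : ∀ k, V ≤ 𝒰.U (σ k)) :
    V ≤ 𝒰.inter σ := le_iInf h

/-- A cochain restricted to an open set, as a function on the simplices whose vertices contain
that set. -/
def localize (V : Opens B) {p : ℕ} (c : Cochain S 𝒰 p)
    (ρ : Fin (p + 1) → {x // V ≤ 𝒰.U x}) : S.sec V :=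
  S.res (Cover.le_inter fun k => (ρ k).2) (c fun k => ρ k)

/-- Restricted to a fixed `V`, all components lie in one group, so identities of Čech cochains
reduce to those on a full simplex. -/
theorem localize_d (V : Opens B) {p : ℕ} (c : Cochain S 𝒰 p) :
    localize S V (d S 𝒰 p c) = simplexD (localize S V c) := by
  funext ρ
  simp only [localize, d, simplexD, MonoidHom.coe_mk, OneHom.coe_mk, map_prod, map_zpow,
    Psh.res_res]
  rfl

/-- The simplex `σ` as a simplex of the covering sets that contain `𝒰.inter σ`. -/
def Cover.vertices (𝒰 : Cover B) {p : ℕ} (σ : Fin (p + 1) → B) (k : Fin (p + 1)) :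
    {x // 𝒰.inter σ ≤ 𝒰.U x} := ⟨σ k, 𝒰.inter_le σ k⟩

theorem localize_vertices {p : ℕ} (c : Cochain S 𝒰 p) (σ : Fin (p + 1) → B) :
    localize S (𝒰.inter σ) c (𝒰.vertices σ) = c σ :=
  S.res_self _

theorem d_d {p : ℕ} (c : Cochain S 𝒰 p) : d S 𝒰 (p + 1) (d S 𝒰 p c) = 1 := by
  funext σ
  rw [← localize_vertices S (d S 𝒰 (p + 1) (d S 𝒰 p c)), localize_d, localize_d, simplexD_simplexD]
  rfl

theorem Cover.inter_le_comp {τ : B → B} (hτ : ∀ x, 𝒱.U x ≤ 𝒰.U (τ x)) {p : ℕ}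
    (σ : Fin (p + 1) → B) : 𝒱.inter σ ≤ 𝒰.inter (τ ∘ σ) :=
  iInf_mono fun k => hτ (σ k)

/-- The map on cochains induced by a map `τ` of indices with `𝒱 x ⊆ 𝒰 (τ x)`. -/
def pull (τ : B → B) (hτ : ∀ x, 𝒱.U x ≤ 𝒰.U (τ x)) (p : ℕ) :
    Cochain S 𝒰 p →* Cochain S 𝒱 p where
  toFun c σ := S.res (Cover.inter_le_comp hτ σ) (c (τ ∘ σ))
  map_one' := by funext σ; simp
  map_mul' c c' := by funext σ; simp

theorem d_pull {τ : B → B} (hτ : ∀ x, 𝒱.U x ≤ 𝒰.U (τ x)) (p : ℕ) (c : Cochain S 𝒰 p) :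
    d S 𝒱 p (pull S τ hτ p c) = pull S τ hτ (p + 1) (d S 𝒰 p c) := by
  funext σ
  simp only [d, pull, MonoidHom.coe_mk, OneHom.coe_mk, map_prod, map_zpow, Psh.res_res]
  rfl

/-- The chain homotopy between `refine` and `pull`. -/
def homotopy (h : 𝒰 ≤ 𝒱) {τ : B → B} (hτ : ∀ x, 𝒱.U x ≤ 𝒰.U (τ x)) (p : ℕ)
    (c : Cochain S 𝒰 (p + 1)) : Cochain S 𝒱 p := fun σ =>
  simplexHomotopy (fun x => ⟨x.1, x.2.trans (h x.1)⟩) (fun x => ⟨τ x.1, x.2.trans (hτ x.1)⟩)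
    (localize S (𝒱.inter σ) c) (𝒱.vertices σ)

theorem localize_homotopy (h : 𝒰 ≤ 𝒱) {τ : B → B} (hτ : ∀ x, 𝒱.U x ≤ 𝒰.U (τ x)) (p : ℕ)
    (c : Cochain S 𝒰 (p + 1)) (V : Opens B) :
    localize S V (homotopy S h hτ p c) =
      simplexHomotopy (fun x => ⟨x.1, x.2.trans (h x.1)⟩) (fun x => ⟨τ x.1, x.2.trans (hτ x.1)⟩)
        (localize S V c) := by
  -- The underlying indices of a prism do not depend on the open set carried along in the vertex
  -- type.
  have hp {V W : Opens B} (e : W ≤ V) (k : Fin (p + 1)) (ρ : Fin (p + 1) → {x // V ≤ 𝒱.U x})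
      (ρ' : Fin (p + 1) → {x // W ≤ 𝒱.U x}) (hρ : ∀ k, (ρ k).1 = ρ' k) (j : Fin (p + 2)) :
      (prism (fun x => ⟨x.1, x.2.trans (h x.1)⟩ : {x // V ≤ 𝒱.U x} → {x // V ≤ 𝒰.U x})
        (fun x => ⟨τ x.1, x.2.trans (hτ x.1)⟩) k ρ j).1 =
      (prism (fun x => ⟨x.1, x.2.trans (h x.1)⟩ : {x // W ≤ 𝒱.U x} → {x // W ≤ 𝒰.U x})
        (fun x => ⟨τ x.1, x.2.trans (hτ x.1)⟩) k ρ' j).1 := by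
    unfold prism
    split_ifs <;> simp [hρ]
  funext ρ
  simp only [localize, homotopy, simplexHomotopy, map_prod, map_zpow, Psh.res_res]
  refine Finset.prod_congr rfl fun k _ => ?_
  congr 1
  have key {σ σ' : Fin (p + 2) → B} (e : σ = σ') (h₁ : V ≤ 𝒰.inter σ) (h₂ : V ≤ 𝒰.inter σ') :
      S.res h₁ (c σ) = S.res h₂ (c σ') := by subst e; rfl
  exact key (funext fun j => hp (Cover.le_inter fun k => (ρ k).2) k _ ρ (fun _ => rfl) j) _ _

theorem homotopy_spec (h : 𝒰 ≤ 𝒱) {τ : B → B} (hτ : ∀ x, 𝒱.U x ≤ 𝒰.U (τ x)) (p : ℕ)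
    (c : Cochain S 𝒰 (p + 1)) :
    d S 𝒱 p (homotopy S h hτ p c) * homotopy S h hτ (p + 1) (d S 𝒰 (p + 1) c) =
      pull S τ hτ (p + 1) c / refine S h (p + 1) c := by
  funext σ
  have := simplexHomotopy_spec
    (fun x => ⟨x.1, x.2.trans (h x.1)⟩ : {x // 𝒱.inter σ ≤ 𝒱.U x} → {x // 𝒱.inter σ ≤ 𝒰.U x})
    (fun x => ⟨τ x.1, x.2.trans (hτ x.1)⟩) (localize S (𝒱.inter σ) c) (𝒱.vertices σ)
  rw [← localize_d, ← localize_homotopy, ← localize_d, ← localize_homotopy, localize_vertices,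
    localize_vertices] at this
  exact this

theorem homotopy_one (h : 𝒰 ≤ 𝒱) {τ : B → B} (hτ : ∀ x, 𝒱.U x ≤ 𝒰.U (τ x)) (p : ℕ) :
    homotopy S h hτ p 1 = 1 := by
  funext σ
  simp [homotopy, simplexHomotopy, localize]

theorem pull_div_refine_mem_bd (h : 𝒰 ≤ 𝒱) {τ : B → B} (hτ : ∀ x, 𝒱.U x ≤ 𝒰.U (τ x)) (p : ℕ)
    (c : Cochain S 𝒰 (p + 1)) (hc : d S 𝒰 (p + 1) c = 1) :
    pull S τ hτ (p + 1) c / refine S h (p + 1) c ∈ bd S 𝒱 (p + 1) := by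
  rw [← homotopy_spec, hc, homotopy_one, mul_one]
  exact ⟨_, rfl⟩

end Pull

section Classes

variable {S : Psh B} {p : ℕ} {𝒰 𝒱 𝒲 : Cover B}

theorem d_refine_eq_one (h : 𝒰 ≤ 𝒱) {c : Cochain S 𝒰 p} (hc : d S 𝒰 p c = 1) :
    d S 𝒱 p (refine S h p c) = 1 := by
  rw [d_refine, hc, map_one]

theorem d_pull_eq_one {τ : B → B} (hτ : ∀ x, 𝒱.U x ≤ 𝒰.U (τ x)) {c : Cochain S 𝒰 p}
    (hc : d S 𝒰 p c = 1) : d S 𝒱 p (pull S τ hτ p c) = 1 := by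
  rw [d_pull, hc, map_one]

theorem cls_eq_cls_iff {c : Cochain S 𝒰 p} {c' : Cochain S 𝒱 p} (hc : d S 𝒰 p c = 1)
    (hc' : d S 𝒱 p c' = 1) :
    cls c hc = cls c' hc' ↔ ∃ (𝒲 : Cover B) (h : 𝒰 ≤ 𝒲) (h' : 𝒱 ≤ 𝒲),
      refine S h' p c' / refine S h p c ∈ bd S 𝒲 p := by
  refine Quotient.eq.trans (exists_congr fun 𝒲 => exists_congr fun h => exists_congr fun h' => ?_)
  refine QuotientGroup.eq.trans ?_
  rw [Subgroup.mem_subgroupOf, div_eq_mul_inv, mul_comm]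
  rfl

theorem exists_cls (x : H S p) : ∃ (𝒰 : Cover B) (c : Cochain S 𝒰 p) (hc : d S 𝒰 p c = 1),
    x = cls c hc := by
  obtain ⟨⟨𝒰, y⟩, rfl⟩ := Quotient.exists_rep x
  obtain ⟨c, rfl⟩ := QuotientGroup.mk_surjective y
  exact ⟨𝒰, c.1, c.2, rfl⟩

theorem cls_refine (h : 𝒰 ≤ 𝒱) {c : Cochain S 𝒰 p} (hc : d S 𝒰 p c = 1) :
    cls (refine S h p c) (d_refine_eq_one h hc) = cls c hc := by
  refine (cls_eq_cls_iff _ _).2 ⟨𝒱, le_rfl, h, ?_⟩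
  have : refine S (le_refl 𝒱) p (refine S h p c) = refine S h p c := by
    funext σ
    exact S.res_self _
  rw [this, div_self']
  exact one_mem _

/-- Transition maps of the direct limit keep indices fixed, whereas lifting requires `τ`. On
cocycles the two differ by a coboundary, through the prism homotopy. -/
theorem cls_pull (hp : p ≠ 0) (h : 𝒰 ≤ 𝒱) {τ : B → B} (hτ : ∀ x, 𝒱.U x ≤ 𝒰.U (τ x))
    {c : Cochain S 𝒰 p} (hc : d S 𝒰 p c = 1) :
    cls (pull S τ hτ p c) (d_pull_eq_one hτ hc) = cls c hc := by
  obtain ⟨p, rfl⟩ := Nat.exists_eq_succ_of_ne_zero hp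
  rw [← cls_refine h hc, eq_comm]
  refine (cls_eq_cls_iff _ _).2 ⟨𝒱, le_rfl, le_rfl, ?_⟩
  have (c : Cochain S 𝒱 (p + 1)) : refine S (le_refl 𝒱) (p + 1) c = c := by
    funext σ
    exact S.res_self _
  rw [this, this]
  exact pull_div_refine_mem_bd S h hτ p c hc

theorem d_mul_eq_one {c c' : Cochain S 𝒰 p} (hc : d S 𝒰 p c = 1) (hc' : d S 𝒰 p c' = 1) :
    d S 𝒰 p (c * c') = 1 := by
  rw [map_mul, hc, hc', mul_one]

theorem cls_mul {c c' : Cochain S 𝒰 p} (hc : d S 𝒰 p c = 1) (hc' : d S 𝒰 p c' = 1) :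
    cls c hc * cls c' hc' = cls (c * c') (d_mul_eq_one hc hc') :=
  DirectLimit.mul_def (G := HCover S p) (f := trans S p) 𝒰 _ _

theorem cls_one : cls (1 : Cochain S 𝒰 p) (map_one _) = 1 :=
  (DirectLimit.one_def (G := HCover S p) (f := trans S p) 𝒰).symm

theorem cls_eq_one_iff {c : Cochain S 𝒰 p} (hc : d S 𝒰 p c = 1) :
    cls c hc = 1 ↔ ∃ (𝒲 : Cover B) (h : 𝒰 ≤ 𝒲), refine S h p c ∈ bd S 𝒲 p := by
  rw [← cls_one (𝒰 := 𝒰), eq_comm, cls_eq_cls_iff]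
  simp

theorem cls_congr {c c' : Cochain S 𝒰 p} (e : c = c') (hc : d S 𝒰 p c = 1)
    (hc' : d S 𝒰 p c' = 1) : cls c hc = cls c' hc' := by
  subst e; rfl

end Classes

end Cech

/-! ### The connecting homomorphism of a short exact sequence of presheaves. -/

namespace Cech

variable {B : Type} [TopologicalSpace B]

section Map

variable {S T : Psh B} (f : S ⟶ T) {𝒰 𝒱 : Cover B} {p : ℕ}

theorem app_res {V W : Opens B} (h : W ≤ V) (s : S.sec V) :
    (f.app (op W)).hom (S.res h s) = T.res h ((f.app (op V)).hom s) :=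
  ConcreteCategory.congr_hom (f.naturality (homOfLE h).op) s

theorem mapCochain_mul (c c' : Cochain S 𝒰 p) :
    mapCochain f (c * c') = mapCochain f c * mapCochain f c' :=
  funext fun _ => map_mul _ _ _

theorem mapCochain_div (c c' : Cochain S 𝒰 p) :
    mapCochain f (c / c') = mapCochain f c / mapCochain f c' :=
  funext fun _ => map_div _ _ _

theorem mapCochain_one : mapCochain f (1 : Cochain S 𝒰 p) = 1 :=
  funext fun _ => map_one _

theorem mapCochain_inv (c : Cochain S 𝒰 p) : mapCochain f c⁻¹ = (mapCochain f c)⁻¹ :=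
  funext fun _ => map_inv _ _

theorem mapCochain_pull {τ : B → B} (hτ : ∀ x, 𝒱.U x ≤ 𝒰.U (τ x)) (c : Cochain S 𝒰 p) :
    mapCochain f (pull S τ hτ p c) = pull T τ hτ p (mapCochain f c) :=
  funext fun _ => app_res f _ _

theorem mapCochain_refine (h : 𝒰 ≤ 𝒱) (c : Cochain S 𝒰 p) :
    mapCochain f (refine S h p c) = refine T h p (mapCochain f c) :=
  funext fun _ => app_res f _ _

theorem mapCochain_d (c : Cochain S 𝒰 p) :
    mapCochain f (d S 𝒰 p c) = d T 𝒰 p (mapCochain f c) := by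
  funext σ
  simp only [mapCochain, d, MonoidHom.coe_mk, OneHom.coe_mk, map_prod, map_zpow, app_res]

end Map

/-- `S₁ → S₂ → S₃` is a short exact sequence; the last map is surjective locally and on sections
over the empty set. -/
structure IsShortExact {S₁ S₂ S₃ : Psh B} (ι : S₁ ⟶ S₂) (q : S₂ ⟶ S₃) : Prop where
  injective : ∀ V : Opens B, Function.Injective (ι.app (op V)).hom
  comp : ∀ (V : Opens B) (y : S₁.sec V), (q.app (op V)).hom ((ι.app (op V)).hom y) = 1
  exact : ∀ (V : Opens B) (x : S₂.sec V), (q.app (op V)).hom x = 1 →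
    ∃ y : S₁.sec V, (ι.app (op V)).hom y = x
  surjective : ∀ (V : Opens B) (s : S₃.sec V), ∀ v ∈ V, ∃ (W : Opens B) (h : W ≤ V), v ∈ W ∧
    ∃ t : S₂.sec W, (q.app (op W)).hom t = S₃.res h s
  surjective_bot : Function.Surjective (q.app (op ⊥)).hom

section Connecting

variable {S₁ S₂ S₃ : Psh B} {ι : S₁ ⟶ S₂} {q : S₂ ⟶ S₃} {p : ℕ} {𝒰 : Cover B}

namespace IsShortExact

variable (hS : IsShortExact ι q)

include hS

theorem mapCochain_injective : Function.Injective (mapCochain ι : Cochain S₁ 𝒰 p → _) :=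
  fun _ _ h => funext fun σ => hS.injective _ (congrFun h σ)

theorem mapCochain_exact (c : Cochain S₂ 𝒰 p) (hc : mapCochain q c = 1) :
    ∃ a : Cochain S₁ 𝒰 p, mapCochain ι a = c := by
  choose a ha using fun σ => hS.exact _ (c σ) (congrFun hc σ)
  exact ⟨a, funext ha⟩

/-- A cochain lifts after passing to a refinement. -/
theorem exists_lift [T2Space B] [ParacompactSpace B] (s : Cochain S₃ 𝒰 p) :
    ∃ (𝒱 : Cover B) (_ : 𝒰 ≤ 𝒱) (τ : B → B) (hτ : ∀ x, 𝒱.U x ≤ 𝒰.U (τ x))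
      (t : Cochain S₂ 𝒱 p), mapCochain q t = pull S₃ τ hτ p s := by
  obtain ⟨𝒱, h, τ, hτ, hQ⟩ := 𝒰.exists_refine
    -- The local property is that the component of `s` at `σ` lifts over `W`.
    (fun σ W => ∃ (h : W ≤ 𝒰.inter σ) (t : S₂.sec W), (q.app (op W)).hom t = S₃.res h (s σ))
    (by
      rintro σ V W hWV ⟨h, t, ht⟩
      exact ⟨hWV.trans h, S₂.res hWV t, by rw [app_res, ht, S₃.res_res]⟩)
    (fun σ => ⟨bot_le, hS.surjective_bot _⟩)
    (fun σ v hv => by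
      obtain ⟨W, h, hv, ht⟩ := hS.surjective _ (s σ) v hv
      exact ⟨W, hv, h, ht⟩)
  choose _ t ht using hQ
  exact ⟨𝒱, h, τ, hτ, t, funext ht⟩

/-- `d t` dies under `q`, hence comes from `S₁`; its preimage is a cocycle because `d ∘ d = 1` and
`ι` is injective. -/
theorem exists_boundary (t : Cochain S₂ 𝒰 p) (hs : d S₃ 𝒰 p (mapCochain q t) = 1) :
    ∃ a : Cochain S₁ 𝒰 (p + 1), d S₁ 𝒰 (p + 1) a = 1 ∧ mapCochain ι a = d S₂ 𝒰 p t := by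
  obtain ⟨a, ha⟩ := hS.mapCochain_exact (d S₂ 𝒰 p t) (by rw [mapCochain_d, hs])
  refine ⟨a, hS.mapCochain_injective ?_, ha⟩
  rw [mapCochain_d, ha, d_d, mapCochain_one]

end IsShortExact

/-- The relation between classes that defines the connecting homomorphism. -/
def connectingRel (ι : S₁ ⟶ S₂) (q : S₂ ⟶ S₃) (p : ℕ) :
    Set (H S₃ p × H S₁ (p + 1)) :=
  {x | ∃ (𝒰 : Cover B) (t : Cochain S₂ 𝒰 p) (a : Cochain S₁ 𝒰 (p + 1))
    (hs : d S₃ 𝒰 p (mapCochain q t) = 1) (ha : d S₁ 𝒰 (p + 1) a = 1),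
    mapCochain ι a = d S₂ 𝒰 p t ∧ x = (cls (mapCochain q t) hs, cls a ha)}

/-- Representatives are moved to a common refinement. Together with closure under inverses, this
reduces single-valuedness of the relation to its fibre over `1`. -/
theorem connectingRel_mul {x y : H S₃ p × H S₁ (p + 1)} (hx : x ∈ connectingRel ι q p)
    (hy : y ∈ connectingRel ι q p) : x * y ∈ connectingRel ι q p := by
  obtain ⟨𝒰, t, a, hs, ha, hat, rfl⟩ := hx
  obtain ⟨𝒰', t', a', hs', ha', hat', rfl⟩ := hy
  obtain ⟨𝒱, h, h'⟩ := exists_ge_ge 𝒰 𝒰'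
  have e₁ : mapCochain q (refine S₂ h p t * refine S₂ h' p t') =
      refine S₃ h p (mapCochain q t) * refine S₃ h' p (mapCochain q t') := by
    rw [mapCochain_mul, mapCochain_refine, mapCochain_refine]
  have e₂ := d_mul_eq_one (d_refine_eq_one h hs) (d_refine_eq_one h' hs')
  refine ⟨𝒱, refine S₂ h p t * refine S₂ h' p t', refine S₁ h _ a * refine S₁ h' _ a',
    e₁ ▸ e₂, d_mul_eq_one (d_refine_eq_one h ha) (d_refine_eq_one h' ha'), ?_,
    Prod.ext ?_ ?_⟩
  · rw [mapCochain_mul, mapCochain_refine, mapCochain_refine, hat, hat', map_mul, d_refine,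
      d_refine]
  · rw [cls_congr e₁ _ e₂, ← cls_mul (d_refine_eq_one h hs) (d_refine_eq_one h' hs'),
      cls_refine, cls_refine]
    rfl
  · rw [← cls_mul (d_refine_eq_one h ha) (d_refine_eq_one h' ha'), cls_refine, cls_refine]
    rfl

theorem d_inv_eq_one {S : Psh B} {c : Cochain S 𝒰 p} (hc : d S 𝒰 p c = 1) :
    d S 𝒰 p c⁻¹ = 1 := by
  rw [map_inv, hc, inv_one]

theorem cls_inv {S : Psh B} {c : Cochain S 𝒰 p} (hc : d S 𝒰 p c = 1) :
    (cls c hc)⁻¹ = cls c⁻¹ (d_inv_eq_one hc) := by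
  rw [inv_eq_iff_mul_eq_one, cls_mul, cls_congr (mul_inv_cancel c) _ (map_one _), cls_one]

theorem connectingRel_inv {x : H S₃ p × H S₁ (p + 1)} (hx : x ∈ connectingRel ι q p) :
    x⁻¹ ∈ connectingRel ι q p := by
  obtain ⟨𝒰, t, a, hs, ha, hat, rfl⟩ := hx
  have e := mapCochain_inv q t
  refine ⟨𝒰, t⁻¹, a⁻¹, e ▸ d_inv_eq_one hs, d_inv_eq_one ha, ?_, Prod.ext ?_ ?_⟩
  · rw [mapCochain_inv, hat, map_inv]
  · rw [cls_congr e _ (d_inv_eq_one hs), ← cls_inv]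
    rfl
  · rw [← cls_inv]
    rfl

namespace IsShortExact

variable [T2Space B] [ParacompactSpace B] (hS : IsShortExact ι q)

include hS

theorem exists_connectingRel (hp : p ≠ 0) (x : H S₃ p) : ∃ y, (x, y) ∈ connectingRel ι q p := by
  obtain ⟨𝒰, s, hs, rfl⟩ := exists_cls x
  obtain ⟨𝒱, h, τ, hτ, t, ht⟩ := hS.exists_lift s
  have hs' := d_pull_eq_one hτ hs
  obtain ⟨a, ha, hat⟩ := hS.exists_boundary t (ht ▸ hs')
  exact ⟨cls a ha, 𝒱, t, a, ht ▸ hs', ha, hat,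
    Prod.ext (by rw [cls_congr ht _ hs', cls_pull hp h]) rfl⟩

/-- If `q t` becomes `d u`, lift `u` to `w` on a further refinement. Then `t / d w` comes from a
cochain `b` of `S₁`, and `d b` is the pullback of `a`. -/
theorem eq_one_of_connectingRel (hp : p ≠ 0) {y : H S₁ (p + 1)}
    (h : (1, y) ∈ connectingRel ι q p) : y = 1 := by
  obtain ⟨𝒰, t, a, hs, ha, hat, e⟩ := h
  obtain ⟨e₁, rfl⟩ := Prod.ext_iff.1 e
  obtain ⟨𝒱, h𝒱, hbd⟩ := (cls_eq_one_iff hs).1 e₁.symm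
  obtain ⟨p, rfl⟩ := Nat.exists_eq_succ_of_ne_zero hp
  obtain ⟨u, hu⟩ := hbd
  obtain ⟨𝒲, h𝒲, τ, hτ, w, hw⟩ := hS.exists_lift u
  rw [← cls_refine h𝒱 ha, ← cls_pull (Nat.succ_ne_zero _) h𝒲 hτ]
  obtain ⟨b, hb⟩ := hS.mapCochain_exact
    (pull S₂ τ hτ (p + 1) (refine S₂ h𝒱 (p + 1) t) / d S₂ 𝒲 p w) (by
      rw [mapCochain_div, mapCochain_pull, mapCochain_refine, mapCochain_d, hw, d_pull, hu,
        div_self'])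
  refine (cls_eq_one_iff _).2 ⟨𝒲, le_rfl, refine_bd _ _ _ _ ⟨b, hS.mapCochain_injective ?_⟩⟩
  rw [mapCochain_d, hb, map_div, d_d, div_one, d_pull, d_refine, ← hat, mapCochain_pull,
    mapCochain_refine]

/-- A short exact sequence has a connecting homomorphism in positive degrees. -/
theorem existsUnique_connecting {p : ℕ} (hp : p ≠ 0) :
    ∃! δ : H S₃ p →* H S₁ (p + 1), IsConnecting ι q p δ := by
  have uniq {x : H S₃ p} {y y'} (h : (x, y) ∈ connectingRel ι q p)
      (h' : (x, y') ∈ connectingRel ι q p) : y = y' := by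
    have := connectingRel_mul h (connectingRel_inv h')
    rw [Prod.inv_mk, Prod.mk_mul_mk, mul_inv_cancel] at this
    exact mul_inv_eq_one.1 (hS.eq_one_of_connectingRel hp this)
  choose δ hδ using hS.exists_connectingRel hp
  refine ⟨MonoidHom.mk' δ fun x y => uniq (hδ _) (connectingRel_mul (hδ x) (hδ y)), ?_, ?_⟩
  · rintro 𝒰 s hs t a ha rfl hat
    exact uniq (hδ _) ⟨𝒰, t, a, hs, ha, hat, rfl⟩
  -- Every class has a representative that lifts on its own covering, and there the defining
  -- property dictates the value.
  · intro δ' hδ'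
    ext x
    obtain ⟨𝒰, t, a, hs, ha, hat, e⟩ := hδ x
    obtain ⟨e₁, e₂⟩ := Prod.ext_iff.1 e
    refine Eq.trans ?_ e₂.symm
    rw [show x = _ from e₁]
    exact hδ' 𝒰 _ hs t a ha rfl hat

end IsShortExact

end Connecting

end Cech

/-! ### Principal bundles and automorphisms over the identity. -/

instance Mfd.paracompactSpace (X : Mfd) : ParacompactSpace X := by
  have := ChartedSpace.locallyCompactSpace (EuclideanSpace ℝ (Fin X.dim)) X
  infer_instance

theorem CentralExt.mul_comm_of_proj (e : CentralExt) {h : e.G} (hh : e.proj h = 1) (g : e.G) :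
    g * h = h * g :=
  Subgroup.mem_center_iff.1 (e.central (MonoidHom.mem_ker.2 hh)) g

namespace PrincipalBundle

variable {X : Mfd} {G : LieGrp} (P : PrincipalBundle X G)

/-- Local trivializations, with the coordinate `d` equivariant and the section `s` normalized. -/
theorem exists_trivialization (x : X) : ∃ W : Opens X, x ∈ W ∧ ∃ (s : X → P.P) (d : P.P → G),
    ContMDiffOn X.I P.P.I ∞ s W ∧ ContMDiffOn P.P.I G.I ∞ d (P.π ⁻¹' W) ∧
    (∀ w ∈ W, P.π (s w) = w) ∧ (∀ b, P.π b ∈ W → P.mul (s (P.π b)) (d b) = b) ∧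
    (∀ w ∈ W, d (s w) = 1) ∧ ∀ b g, P.π b ∈ W → d (P.mul b g) = d b * g := by
  obtain ⟨W, hx, s, d, hs, hd, hπ, hb, hg⟩ := P.locally_trivial x
  refine ⟨W, hx, s, d, hs, hd, hπ, hb, fun w hw => ?_, fun b g hbW => ?_⟩
  · simpa [P.mul_one] using hg w hw 1
  · conv_lhs => rw [← hb b hbW, ← P.mul_mul]
    exact hg _ hbW _

theorem mul_injective (b : P.P) : Function.Injective (P.mul b) := by
  intro g h e
  obtain ⟨W, hx, s, d, -, -, -, -, -, hd⟩ := P.exists_trivialization (P.π b)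
  have := congrArg d e
  rwa [hd _ _ hx, hd _ _ hx, mul_right_inj] at this

theorem π_surjective : Function.Surjective P.π := by
  intro x
  obtain ⟨W, hx, s, d, -, -, hs, -⟩ := P.exists_trivialization x
  exact ⟨s x, hs x hx⟩

theorem exists_mul_eq {b b' : P.P} (h : P.π b = P.π b') : ∃ g, P.mul b g = b' := by
  obtain ⟨W, hx, s, d, -, -, -, hd, -⟩ := P.exists_trivialization (P.π b)
  have h₁ := hd b hx
  have h₂ := hd b' (h ▸ hx)
  rw [← h] at h₂
  refine ⟨(d b)⁻¹ * d b', ?_⟩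
  calc P.mul b ((d b)⁻¹ * d b')
      = P.mul (P.mul (s (P.π b)) (d b)) ((d b)⁻¹ * d b') := by rw [h₁]
    _ = b' := by rw [← P.mul_mul, mul_inv_cancel_left, h₂]

end PrincipalBundle

theorem AssocBundle.exists_ρ_eq {X : Mfd} {G : LieGrp} {P : PrincipalBundle X G} {Y : Mfd}
    {a : SmoothAction G Y} {E : Mfd} (A : AssocBundle P a E) (z : E) : ∃ q y, A.ρ q y = z := by
  obtain ⟨W, hx, s, η, -, -, -, h⟩ := A.locally_trivial (A.π z)
  exact ⟨_, _, h z hx⟩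

namespace Tower

variable {D : LiftingProblem} (T : Tower D)

theorem vert_injective (i : ℕ) (V : Opens (D.F 0)) : Function.Injective (T.vert i V) := by
  intro h h' e
  funext ⟨v, x⟩
  obtain ⟨b, rfl⟩ := (T.P i).π_surjective x
  exact (T.P i).mul_injective b (congrArg (fun f : T.Pm i V => f v b) e)

variable {T}

/-- An automorphism that lies over the identity is the action of a function. -/
theorem IsLift.exists_vert {i : ℕ} {V : Opens (D.F 0)} {ψ : T.Pm (i + 1) V}
    (hψ : T.IsLift i V 1 ψ) : ∃ h, T.IsHFn (i + 1) V h ∧ T.vert (i + 1) V h = ψ := by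
  obtain ⟨hs, -, hm, hκ⟩ := hψ
  have hκ' (v b) : T.κ i (ψ v b) = T.κ i b := by
    obtain ⟨q, y, hq⟩ := (T.r i).exists_ρ_eq (T.κ i b)
    rw [hκ v b q y hq.symm, ← hq]
    simp
  have hπ (v b) : (T.P (i + 1)).π b = (T.P (i + 1)).π (ψ v b) := by
    obtain ⟨q, y, hq⟩ := (T.r i).exists_ρ_eq (T.κ i b)
    rw [T.κ_over i b q y hq.symm, T.κ_over i (ψ v b) q y ((hκ' v b).trans hq.symm)]
  choose frame hframe using (T.P (i + 1)).π_surjective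
  choose g hg using fun v b => (T.P (i + 1)).exists_mul_eq (hπ v b)
  -- Since `ψ` fixes `κ b`, equivariance of `κ` and freeness of the `K`-action force `g` into the
  -- central subgroup.
  have hproj (v b) : (D.ext (i + 1)).proj (g v b) = 1 := by
    obtain ⟨q, y, hq⟩ := (T.r i).exists_ρ_eq (T.κ i b)
    have h := T.κ_mul i b q y (g v b) hq.symm
    rw [hg, hκ', ← hq] at h
    refine ((D.pK (i + 1)).mul_injective y ((T.r i).ρ_injective q ?_)).symm
    rw [(D.pK (i + 1)).mul_one, h]
  -- Replacing `b` by another point of its fibre conjugates `g`, which does nothing to a central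
  -- element; so `g` descends to the base.
  have hgf (v b) : g v (frame ((T.P (i + 1)).π b)) = g v b := by
    obtain ⟨k, hk⟩ := (T.P (i + 1)).exists_mul_eq (hframe ((T.P (i + 1)).π b))
    refine (T.P (i + 1)).mul_injective b ?_
    rw [hg]
    nth_rw 1 [← hk]
    nth_rw 3 [← hk]
    rw [hm, ← hg v (frame _), ← (T.P (i + 1)).mul_mul, ← (T.P (i + 1)).mul_mul,
      (D.ext (i + 1)).mul_comm_of_proj (hproj _ _)]
  refine ⟨fun p => g p.1 (frame p.2), ⟨?_, fun p => hproj _ _⟩, ?_⟩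
  · rintro ⟨v, x⟩
    obtain ⟨W, hx, s, d, hsec, hd, hsπ, -, hds, hdm⟩ := (T.P (i + 1)).exists_trivialization x
    have hW : (W : Set (T.X (i + 1))) ∈ nhds x := W.2.mem_nhds hx
    -- `frame` is an arbitrary choice, not a smooth one. Near `x` it may be replaced by the smooth
    -- section `s`, where the coordinate `d` reads off the function.
    have e : (fun p : V × T.X (i + 1) => g p.1 (frame p.2)) =ᶠ[nhds (v, x)]
        fun p => d (ψ p.1 (s p.2)) := by
      filter_upwards [(continuous_snd.tendsto (v, x)).eventually hW] with p hp
      have hp' : p.2 ∈ W := hp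
      have : g p.1 (frame p.2) = g p.1 (s p.2) := by
        rw [← hgf p.1 (s p.2), hsπ _ hp']
      rw [this, ← hg p.1 (s p.2), hdm _ _ (by rwa [hsπ _ hp']), hds _ hp', one_mul]
    refine ContMDiffAt.congr_of_eventuallyEq ?_ e
    have h₁ : ContMDiffAt ((D.F 0).I.prod (T.X (i + 1)).I)
        ((D.F 0).I.prod (T.P (i + 1)).P.I) ∞ (fun p : V × T.X (i + 1) => (p.1, s p.2)) (v, x) :=
      contMDiffAt_fst.prodMk ((hsec.contMDiffAt hW).comp (v, x) contMDiffAt_snd)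
    have h₂ := (hs (v, s x)).comp (v, x) h₁
    refine ContMDiffAt.comp (v, x) (hd.contMDiffAt ?_) h₂
    refine (W.2.preimage (T.P (i + 1)).smooth_π.continuous).mem_nhds ?_
    change (T.P (i + 1)).π (ψ v (s x)) ∈ W
    rwa [← hπ, hsπ _ hx]
  · funext v
    ext b
    change (T.P (i + 1)).mul b (g v (frame _)) = ψ v b
    rw [hgf, hg]

/-! ### The exact sequences of the tower, and pullback of classifying cochains. -/

namespace Sheaves

variable (S : T.Sheaves)

theorem isShortExact (i : ℕ) : Cech.IsShortExact (S.incl i) (S.toA i) where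
  injective V h h' e := by
    refine Subtype.ext (T.vert_injective (i + 1) V ?_)
    exact congrArg (fun x : S.E i V => x.1.2) e
  comp V y := rfl
  exact V x hx := by
    obtain ⟨⟨φ, ψ⟩, hE⟩ := x
    obtain rfl : φ = 1 := congrArg Subtype.val hx
    obtain ⟨h, hh, rfl⟩ := (S.lift_of_mem i V _ hE).2.exists_vert
    exact ⟨⟨h, (S.mem_A_succ i V h).2 ⟨hh, hE⟩⟩, rfl⟩
  surjective V f v hv := by
    obtain ⟨W, h, hv, ψ, hψ⟩ := S.E_surjective i V f.1 f.2 v hv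
    exact ⟨W, h, hv, ⟨_, hψ⟩, rfl⟩
  -- Over the empty set the gluing condition is vacuous, so any second component is allowed.
  surjective_bot f := ⟨⟨(f.1, 1), S.E_local i ⊥ _ fun v hv => hv.elim⟩, rfl⟩

theorem IsClassifyingFirst.pull {𝒰 𝒱 : Cech.Cover (D.F 0)} {c : Cech.Cochain (S.shA 0) 𝒰 2}
    (hc : S.IsClassifyingFirst 𝒰 c) {τ : D.F 0 → D.F 0} (hτ : ∀ x, 𝒱.U x ≤ 𝒰.U (τ x)) :
    S.IsClassifyingFirst 𝒱 (Cech.pull (S.shA 0) τ hτ 2 c) := by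
  obtain ⟨s, k, g, hs, hπ, hk, hg, hgk, h⟩ := hc
  have hτ' (x y) : 𝒱.U x ⊓ 𝒱.U y ≤ 𝒰.U (τ x) ⊓ 𝒰.U (τ y) := inf_le_inf (hτ x) (hτ y)
  exact ⟨fun x v => s (τ x) (Opens.inclusion (hτ x) v),
    fun x y v => k (τ x) (τ y) (Opens.inclusion (hτ' x y) v),
    fun x y v => g (τ x) (τ y) (Opens.inclusion (hτ' x y) v),
    fun x => (hs _).comp (contMDiff_inclusion _), fun x v => hπ _ _, fun x y v => hk (τ x) (τ y) (Opens.inclusion (hτ' x y) v),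
    fun x y => (hg _ _).comp (contMDiff_inclusion _), fun x y v => hgk _ _ _,
    fun σ v a => h (τ ∘ σ) ⟨v, Cech.Cover.inter_le_comp hτ σ v.2⟩ a⟩

/-- All choices at all levels can be reindexed along `τ`. This lets the construction continue on the
refinements where lifts exist. -/
theorem IsClassifying.pull : ∀ {i : ℕ} {𝒰 𝒱 : Cech.Cover (D.F 0)}
    {c : Cech.Cochain (S.shA i) 𝒰 (i + 2)} (_ : S.IsClassifying i 𝒰 c) {τ : D.F 0 → D.F 0}
    (hτ : ∀ x, 𝒱.U x ≤ 𝒰.U (τ x)),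
    S.IsClassifying i 𝒱 (Cech.pull (S.shA i) τ hτ (i + 2) c)
  | 0, _, _, _, hc, _, hτ => IsClassifyingFirst.pull S hc hτ
  | i + 1, 𝒰, 𝒱, c, ⟨c', t, hc', ht, h⟩, τ, hτ => by
    refine ⟨_, Cech.pull (S.shE i) τ hτ (i + 2) t, IsClassifying.pull hc' hτ, fun σ => ?_,
      fun σ => ?_⟩
    · exact congrArg (T.resFn i (Cech.Cover.inter_le_comp hτ σ)) (ht (τ ∘ σ))
    · rw [Cech.d_pull]
      exact congrArg (T.resPm (i + 1) (Cech.Cover.inter_le_comp hτ σ)) (h (τ ∘ σ))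

variable {S}

/-- The data of a classifying cochain of the next level, in terms of the short exact sequence. -/
theorem isClassifying_succ_iff {i : ℕ} {𝒰 : Cech.Cover (D.F 0)}
    (hcoc : ∀ c, S.IsClassifying i 𝒰 c → Cech.d (S.shA i) 𝒰 (i + 2) c = 1)
    {c : Cech.Cochain (S.shA (i + 1)) 𝒰 (i + 3)} :
    S.IsClassifying (i + 1) 𝒰 c ↔ ∃ t : Cech.Cochain (S.shE i) 𝒰 (i + 2),
      S.IsClassifying i 𝒰 (Cech.mapCochain (S.toA i) t) ∧
      Cech.mapCochain (S.incl i) c = Cech.d (S.shE i) 𝒰 (i + 2) t := by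
  constructor
  · rintro ⟨c', t, hc', ht, h⟩
    obtain rfl : Cech.mapCochain (S.toA i) t = c' := funext fun σ => Subtype.ext (ht σ)
    refine ⟨t, hc', funext fun σ => Subtype.ext (Prod.ext ?_ (h σ))⟩
    -- Only the automorphism part of `d t` is prescribed; its function part is `d c'`, trivial
    -- because `c'` is a cocycle.
    have := hcoc _ hc'
    rw [← Cech.mapCochain_d] at this
    exact (congrArg Subtype.val (congrFun this σ)).symm
  · rintro ⟨t, ht, h⟩
    exact ⟨_, t, ht, fun σ => rfl, fun σ =>
      congrArg (fun x : S.E i (𝒰.inter σ) => x.1.2) (congrFun h σ)⟩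

end Sheaves

end Tower

/-! ### The first lifting problem. -/

theorem Cech.d_one_apply {B : Type} [TopologicalSpace B] (S : Psh B) (𝒰 : Cover B)
    (c : Cochain S 𝒰 1) (σ : Fin 3 → B) :
    d S 𝒰 1 c σ = S.res (𝒰.inter_face σ 0) (c _) * (S.res (𝒰.inter_face σ 1) (c _))⁻¹ *
      S.res (𝒰.inter_face σ 2) (c _) := by
  simp only [d, MonoidHom.coe_mk, OneHom.coe_mk]
  rw [Fin.prod_univ_three]
  simp

theorem Cech.d_two_apply {B : Type} [TopologicalSpace B] (S : Psh B) (𝒰 : Cover B)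
    (c : Cochain S 𝒰 2) (σ : Fin 4 → B) :
    d S 𝒰 2 c σ = S.res (𝒰.inter_face σ 0) (c _) * (S.res (𝒰.inter_face σ 1) (c _))⁻¹ *
      S.res (𝒰.inter_face σ 2) (c _) * (S.res (𝒰.inter_face σ 3) (c _))⁻¹ := by
  simp only [d, MonoidHom.coe_mk, OneHom.coe_mk]
  rw [Fin.prod_univ_four]
  simp [pow_succ]

/-- The cocycle identity for the defect `x * y * z⁻¹` of central lifts. -/
theorem central_defect_cocycle {G : Type*} [Group G] {g₀₁ g₀₂ g₀₃ g₁₂ g₁₃ g₂₃ a b c e : G}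
    (ha : a = g₁₂ * g₂₃ * g₁₃⁻¹) (hb : b = g₀₂ * g₂₃ * g₀₃⁻¹) (hc : c = g₀₁ * g₁₃ * g₀₃⁻¹)
    (he : e = g₀₁ * g₁₂ * g₀₂⁻¹) (ca : ∀ x, x * a = a * x) (cb : ∀ x, x * b = b * x) :
    a * b⁻¹ * c * e⁻¹ = 1 := by
  -- Both sides are `g₀₁ * g₁₂ * g₂₃ * g₀₃⁻¹`, the right one after moving the central `a` past
  -- `g₀₁`.
  have h : e * b = a * c := by
    calc e * b = g₀₁ * (g₁₂ * g₂₃ * g₁₃⁻¹) * g₁₃ * g₀₃⁻¹ := by rw [he, hb]; group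
      _ = a * c := by rw [← ha, ca, hc]; group
  have h' : a * b⁻¹ = b⁻¹ * a := (show Commute a b from cb a).inv_right
  rw [h', mul_assoc b⁻¹, ← h, cb e]
  group

/-- Two defects of central lifts of equivalent transition functions differ by a coboundary. -/
theorem central_defect_coboundary {G : Type*} [Group G]
    {m₀ m₁ m₂ g₀₁ g₀₂ g₁₂ g'₀₁ g'₀₂ g'₁₂ h₀₁ h₀₂ h₁₂ c c' : G}
    (hc : c = g₀₁ * g₁₂ * g₀₂⁻¹) (hc' : c' = g'₀₁ * g'₁₂ * g'₀₂⁻¹)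
    (e₀₁ : h₀₁ = g₀₁⁻¹ * m₀ * g'₀₁ * m₁⁻¹) (e₁₂ : h₁₂ = g₁₂⁻¹ * m₁ * g'₁₂ * m₂⁻¹)
    (e₀₂ : h₀₂ = g₀₂⁻¹ * m₀ * g'₀₂ * m₂⁻¹) (cc : ∀ x, x * c = c * x) (cc' : ∀ x, x * c' = c' * x)
    (c₀₁ : ∀ x, x * h₀₁ = h₀₁ * x) (c₁₂ : ∀ x, x * h₁₂ = h₁₂ * x) :
    h₁₂ * h₀₂⁻¹ * h₀₁ = c' * c⁻¹ := by
  have h : c' * h₀₂ = h₁₂ * h₀₁ * c := by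
    calc c' * h₀₂ = g₀₂⁻¹ * m₀ * c' * g'₀₂ * m₂⁻¹ := by rw [cc', e₀₂]; group
      _ = g₀₂⁻¹ * m₀ * g'₀₁ * g'₁₂ * m₂⁻¹ := by rw [hc']; group
      _ = g₀₂⁻¹ * (g₀₁ * h₀₁) * (g₁₂ * h₁₂) := by rw [e₀₁, e₁₂]; group
      _ = h₁₂ * h₀₁ * (g₀₂⁻¹ * (g₀₁ * g₁₂ * g₀₂⁻¹) * g₀₂) := by
        rw [c₀₁ g₀₁, ← mul_assoc, c₁₂, ← mul_assoc g₀₂⁻¹, c₀₁ g₀₂⁻¹]; group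
      _ = h₁₂ * h₀₁ * c := by rw [← hc, cc]; group
  rw [mul_assoc, c₀₁, ← mul_assoc, eq_mul_inv_of_mul_eq h, mul_assoc _ c, ← cc]
  group

/-- The quotient of two local sections of a principal bundle lifts locally to the extension. -/
theorem PrincipalBundle.exists_lift_quotient {X : Mfd} {e : CentralExt}
    (P : PrincipalBundle X e.K) {U : Opens X} {s s' : U → P.P} (hs : ContMDiff X.I P.P.I ∞ s)
    (hs' : ContMDiff X.I P.P.I ∞ s') (hπ : ∀ v, P.π (s v) = v) (hπ' : ∀ v, P.π (s' v) = v)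
    {x : X} (hx : x ∈ U) :
    ∃ (V : Opens X) (h : V ≤ U), x ∈ V ∧ ∃ m : V → e.G, ContMDiff X.I e.G.I ∞ m ∧
      ∀ v, s' (Opens.inclusion h v) = P.mul (s (Opens.inclusion h v)) (e.proj (m v)) := by
  obtain ⟨W, hxW, -, d, -, hd, -, -, -, hdm⟩ := P.exists_trivialization x
  have hU : U ⊓ W ≤ U := inf_le_left
  -- In the trivialization, `q` is the smooth function with `s' = s · q`; it is then composed with a
  -- local section of `G → K`.
  let q : (U ⊓ W : Opens X) → e.K := fun v =>
    (d (s (Opens.inclusion hU v)))⁻¹ * d (s' (Opens.inclusion hU v))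
  have hq : ContMDiff X.I e.K.I ∞ q := by
    have h₁ := hd.comp_contMDiff (hs.comp (contMDiff_inclusion hU)) (fun v => by
      change P.π (s _) ∈ W
      rw [hπ]
      exact v.2.2)
    have h₂ := hd.comp_contMDiff (hs'.comp (contMDiff_inclusion hU)) (fun v => by
      change P.π (s' _) ∈ W
      rw [hπ']
      exact v.2.2)
    exact h₁.inv.mul h₂
  have hmul (v : (U ⊓ W : Opens X)) :
      s' (Opens.inclusion hU v) = P.mul (s (Opens.inclusion hU v)) (q v) := by
    obtain ⟨g, hg⟩ := P.exists_mul_eq ((hπ (Opens.inclusion hU v)).trans (hπ' _).symm)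
    have : d (s' (Opens.inclusion hU v)) = d (s (Opens.inclusion hU v)) * g := by
      rw [← hg, hdm _ _ (by rw [hπ]; exact v.2.2)]
    simp only [q, this, inv_mul_cancel_left, hg]
  obtain ⟨N, hN, σ, hσ, hσN⟩ := e.local_sections (q ⟨x, hx, hxW⟩)
  let V : Opens X := ⟨Subtype.val '' (q ⁻¹' N), (U ⊓ W).2.isOpenMap_subtype_val _
    (N.2.preimage hq.continuous)⟩
  have hV : V ≤ U ⊓ W := by
    rintro _ ⟨v, -, rfl⟩
    exact v.2
  have hVN (v : V) : q (Opens.inclusion hV v) ∈ N := by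
    obtain ⟨_, w, hw, rfl⟩ := v
    exact hw
  refine ⟨V, hV.trans hU, ⟨_, hN, rfl⟩, fun v => σ (q (Opens.inclusion hV v)),
    hσ.comp_contMDiff (hq.comp (contMDiff_inclusion hV)) hVN, fun v => ?_⟩
  rw [hσN _ (hVN v)]
  exact hmul (Opens.inclusion hV v)

namespace Tower.Sheaves

variable {D : LiftingProblem} {T : Tower D} (S : T.Sheaves)

theorem mul_comm_of_mem {i : ℕ} {V : Opens (D.F 0)} (f : S.A i V) (p : V × T.X i)
    (g : (D.ext i).G) : g * f.1 p = f.1 p * g :=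
  (D.ext i).mul_comm_of_proj ((S.isHFn_of_mem f.2).2 p) g

/-- The section of `A 0` given by a smooth function with values in the central subgroup. -/
def ofSmooth {V : Opens (D.F 0)} (f : V → (D.ext 0).G) (hf : ContMDiff (D.F 0).I (D.ext 0).G.I ∞ f)
    (hp : ∀ v, (D.ext 0).proj (f v) = 1) : S.A 0 V :=
  ⟨fun p => f p.1, (S.mem_A_zero V _).2 ⟨hf.comp contMDiff_fst, fun p => hp p.1⟩⟩

variable {S}

theorem IsClassifyingFirst.d_eq_one {𝒰 : Cech.Cover (D.F 0)} {c : Cech.Cochain (S.shA 0) 𝒰 2}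
    (hc : S.IsClassifyingFirst 𝒰 c) : Cech.d (S.shA 0) 𝒰 2 c = 1 := by
  obtain ⟨s, k, g, -, -, -, -, -, h⟩ := hc
  funext σ
  rw [Cech.d_two_apply]
  refine Subtype.ext (funext fun ⟨v, a⟩ => ?_)
  have hv (j : Fin 4) := 𝒰.inter_face σ j v.2
  exact central_defect_cocycle (h (σ ∘ Fin.succAbove 0) ⟨v, hv 0⟩ a)
    (h (σ ∘ Fin.succAbove 1) ⟨v, hv 1⟩ a) (h (σ ∘ Fin.succAbove 2) ⟨v, hv 2⟩ a)
    (h (σ ∘ Fin.succAbove 3) ⟨v, hv 3⟩ a) (S.mul_comm_of_mem _ _) (S.mul_comm_of_mem _ _)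

/-- On a finer covering the two systems of sections differ by functions `m x` lifted to `G`. The
lifts `g` and `g'` then match up to a central 1-cochain, whose boundary is the quotient of the
cocycles. -/
theorem IsClassifyingFirst.cls_eq {𝒰 𝒰' : Cech.Cover (D.F 0)} {c : Cech.Cochain (S.shA 0) 𝒰 2}
    {c' : Cech.Cochain (S.shA 0) 𝒰' 2} (hc : S.IsClassifyingFirst 𝒰 c)
    (hc' : S.IsClassifyingFirst 𝒰' c') :
    Cech.cls c hc.d_eq_one = Cech.cls c' hc'.d_eq_one := by
  refine (Cech.cls_eq_cls_iff _ _).2 ?_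
  obtain ⟨s, k, g, hs, hπ, hk, hg, hgk, h⟩ := hc
  obtain ⟨s', k', g', hs', hπ', hk', hg', hgk', h'⟩ := hc'
  have hloc (x : D.F 0) := (D.pK 0).exists_lift_quotient (e := D.ext 0)
    (U := 𝒰.U x ⊓ 𝒰'.U x) ((hs x).comp (contMDiff_inclusion inf_le_left))
    ((hs' x).comp (contMDiff_inclusion inf_le_right)) (fun v => hπ _ _) (fun v => hπ' _ _)
    ⟨𝒰.mem x, 𝒰'.mem x⟩
  choose V hV hxV m hm hms using hloc
  let 𝒱 : Cech.Cover (D.F 0) := ⟨V, hxV⟩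
  have h𝒰 : 𝒰 ≤ 𝒱 := fun x => (hV x).trans inf_le_left
  have h𝒰' : 𝒰' ≤ 𝒱 := fun x => (hV x).trans inf_le_right
  let b (x y : D.F 0) (v : (V x ⊓ V y : Opens (D.F 0))) : (D.ext 0).G :=
    (g x y (Opens.inclusion (inf_le_inf (h𝒰 x) (h𝒰 y)) v))⁻¹ * m x (Opens.inclusion inf_le_left v) *
      g' x y (Opens.inclusion (inf_le_inf (h𝒰' x) (h𝒰' y)) v) *
      (m y (Opens.inclusion inf_le_right v))⁻¹
  have hb (x y) : ContMDiff (D.F 0).I (D.ext 0).G.I ∞ (b x y) :=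
    ((((hg x y).comp (contMDiff_inclusion _)).inv.mul ((hm x).comp (contMDiff_inclusion _))).mul
      ((hg' x y).comp (contMDiff_inclusion _))).mul ((hm y).comp (contMDiff_inclusion _)).inv
  -- There are two ways to pass from `s x` to `s' y`, through `s y` or through `s' x`; they agree in
  -- `K` by freeness.
  have hbp (x y v) : (D.ext 0).proj (b x y v) = 1 := by
    have h₁ := hk x y (Opens.inclusion (inf_le_inf (h𝒰 x) (h𝒰 y)) v)
    have h₂ := hk' x y (Opens.inclusion (inf_le_inf (h𝒰' x) (h𝒰' y)) v)
    have h₃ := hms x (Opens.inclusion inf_le_left v)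
    have h₄ := hms y (Opens.inclusion inf_le_right v)
    rw [← hgk] at h₁
    rw [← hgk'] at h₂
    have e := (h₄.symm.trans h₂).trans (congrArg (fun z => (D.pK 0).mul z _) h₃)
    have e' := (congrArg (fun z => (D.pK 0).mul z _) h₁).symm.trans e
    rw [← (D.pK 0).mul_mul, ← (D.pK 0).mul_mul] at e'
    have e'' := (D.pK 0).mul_injective _ e'
    simp only [b, map_mul, map_inv]
    rw [mul_inv_eq_one, mul_assoc, ← e'', inv_mul_cancel_left]
  have hσ {p : ℕ} (σ : Fin (p + 1) → D.F 0) (j k) : 𝒱.inter σ ≤ V (σ j) ⊓ V (σ k) :=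
    le_inf (𝒱.inter_le σ j) (𝒱.inter_le σ k)
  let β : Cech.Cochain (S.shA 0) 𝒱 1 := fun σ =>
    S.ofSmooth (fun v => b (σ 0) (σ 1) (Opens.inclusion (hσ σ 0 1) v))
      ((hb _ _).comp (contMDiff_inclusion _)) (fun v => hbp _ _ _)
  refine ⟨𝒱, h𝒰, h𝒰', β, ?_⟩
  funext σ
  rw [Cech.d_one_apply, Pi.div_apply, div_eq_mul_inv]
  refine Subtype.ext (funext fun ⟨v, a⟩ => ?_)
  exact central_defect_coboundary (h σ ⟨v, Cech.Cover.inter_mono h𝒰 σ v.2⟩ a)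
    (h' σ ⟨v, Cech.Cover.inter_mono h𝒰' σ v.2⟩ a) (e₀₁ := rfl) (e₁₂ := rfl) (e₀₂ := rfl)
    (S.mul_comm_of_mem _ _) (S.mul_comm_of_mem _ _)
    ((D.ext 0).mul_comm_of_proj (hbp _ _ _)) ((D.ext 0).mul_comm_of_proj (hbp _ _ _))

variable (S)

theorem exists_isClassifyingFirst : ∃ 𝒰 c, S.IsClassifyingFirst 𝒰 c := by
  choose W hW s _ hs _ hπ _ _ _ using fun x : D.F 0 => (D.pK 0).exists_trivialization x
  let 𝒰 : Cech.Cover (D.F 0) := ⟨W, hW⟩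
  let s' (x : D.F 0) (v : W x) : (D.pK 0).P := s x v
  have hs' (x) : ContMDiff (D.F 0).I (D.pK 0).P.I ∞ (s' x) :=
    (hs x).comp_contMDiff contMDiff_subtype_val fun v => v.2
  -- Transition functions lift to `G` only locally on double intersections, so the refinement is
  -- adapted to 1-simplices.
  obtain ⟨𝒱, -, τ, hτ, hQ⟩ := 𝒰.exists_refine (p := 1) (fun σ V => ∃ m : V → (D.ext 0).G,
      ContMDiff (D.F 0).I (D.ext 0).G.I ∞ m ∧
        ∀ v : V, s (σ 1) v = (D.pK 0).mul (s (σ 0) v) ((D.ext 0).proj (m v)))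
    (by
      rintro σ V V' h ⟨m, hm, hms⟩
      exact ⟨fun v => m (Opens.inclusion h v), hm.comp (contMDiff_inclusion h),
        fun v => hms (Opens.inclusion h v)⟩)
    (fun σ => ⟨1, contMDiff_const, fun v => v.2.elim⟩)
    (fun σ v hv => by
      obtain ⟨V, h, hvV, m, hm, hms⟩ := (D.pK 0).exists_lift_quotient (e := D.ext 0)
        ((hs' (σ 0)).comp (contMDiff_inclusion (𝒰.inter_le σ 0)))
        ((hs' (σ 1)).comp (contMDiff_inclusion (𝒰.inter_le σ 1)))
        (fun v => hπ _ _ (𝒰.inter_le σ 0 v.2)) (fun v => hπ _ _ (𝒰.inter_le σ 1 v.2)) hv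
      exact ⟨V, hvV, m, hm, hms⟩)
  choose m hm hms using hQ
  have hxy (x y : D.F 0) : 𝒱.U x ⊓ 𝒱.U y ≤ 𝒱.inter ![x, y] :=
    Cech.Cover.le_inter (Fin.forall_fin_two.2 ⟨inf_le_left, inf_le_right⟩)
  let g (x y : D.F 0) (v : (𝒱.U x ⊓ 𝒱.U y : Opens (D.F 0))) : (D.ext 0).G :=
    m ![x, y] (Opens.inclusion (hxy x y) v)
  have hg (x y) : ContMDiff (D.F 0).I (D.ext 0).G.I ∞ (g x y) :=
    (hm _).comp (contMDiff_inclusion _)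
  have hgs (x y v) : s (τ y) v.1 = (D.pK 0).mul (s (τ x) v.1) ((D.ext 0).proj (g x y v)) :=
    hms ![x, y] (Opens.inclusion (hxy x y) v)
  have hσ (σ : Fin 3 → D.F 0) (j k) : 𝒱.inter σ ≤ 𝒱.U (σ j) ⊓ 𝒱.U (σ k) :=
    le_inf (𝒱.inter_le σ j) (𝒱.inter_le σ k)
  let gσ (σ : Fin 3 → D.F 0) (j k) (v : 𝒱.inter σ) : (D.ext 0).G :=
    g (σ j) (σ k) (Opens.inclusion (hσ σ j k) v)
  have hgσ (σ j k) : ContMDiff (D.F 0).I (D.ext 0).G.I ∞ (gσ σ j k) :=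
    (hg _ _).comp (contMDiff_inclusion _)
  refine ⟨𝒱, fun σ => S.ofSmooth (fun v => gσ σ 0 1 v * gσ σ 1 2 v * (gσ σ 0 2 v)⁻¹)
      (((hgσ σ 0 1).mul (hgσ σ 1 2)).mul (hgσ σ 0 2).inv) fun v => ?_,
    fun x v => s' (τ x) (Opens.inclusion (hτ x) v), fun x y v => (D.ext 0).proj (g x y v), g,
    fun x => (hs' _).comp (contMDiff_inclusion _), fun x v => hπ _ _ (hτ x v.2),
    fun x y v => hgs x y v, hg, fun _ _ _ => rfl, fun σ v a => rfl⟩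
  -- The defect is central because the projected transition functions compose: both sides carry the
  -- section at `σ 0` to that at `σ 2`.
  rw [map_mul, map_mul, map_inv, mul_inv_eq_one]
  refine (D.pK 0).mul_injective (s (τ (σ 0)) v.1) ?_
  have h₁ := hgs _ _ (Opens.inclusion (hσ σ 0 1) v)
  have h₂ := hgs _ _ (Opens.inclusion (hσ σ 1 2) v)
  have h₃ := hgs _ _ (Opens.inclusion (hσ σ 0 2) v)
  rw [(D.pK 0).mul_mul]
  exact (congrArg (fun z => (D.pK 0).mul z _) h₁.symm).trans (h₂.symm.trans h₃)

/-! ### Induction over the levels of the tower. -/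

variable {S}

theorem IsClassifying.d_eq_one {i : ℕ} {𝒰 : Cech.Cover (D.F 0)}
    {c : Cech.Cochain (S.shA i) 𝒰 (i + 2)} (hc : S.IsClassifying i 𝒰 c) :
    Cech.d (S.shA i) 𝒰 (i + 2) c = 1 := by
  induction i with
  | zero => exact IsClassifyingFirst.d_eq_one hc
  | succ i ih =>
    obtain ⟨t, -, h⟩ := (isClassifying_succ_iff fun c hc => ih hc).1 hc
    refine (S.isShortExact i).mapCochain_injective ?_
    rw [Cech.mapCochain_d, h, Cech.d_d, Cech.mapCochain_one]

/-- A connecting homomorphism maps the class of a classifying cocycle to that of the classifying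
cocycles of the next level that are formed from it. -/
theorem IsClassifying.exists_connecting {i : ℕ} {𝒰 : Cech.Cover (D.F 0)}
    {c : Cech.Cochain (S.shA (i + 1)) 𝒰 (i + 2 + 1)} (hc : S.IsClassifying (i + 1) 𝒰 c) :
    ∃ (c₀ : Cech.Cochain (S.shA i) 𝒰 (i + 2)) (hc₀ : S.IsClassifying i 𝒰 c₀),
      ∀ δ, Cech.IsConnecting (S.incl i) (S.toA i) (i + 2) δ →
        δ (Cech.cls c₀ hc₀.d_eq_one) = Cech.cls c hc.d_eq_one := by
  obtain ⟨t, ht, h⟩ := (isClassifying_succ_iff fun c hc => hc.d_eq_one).1 hc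
  exact ⟨_, ht, fun δ hδ => hδ 𝒰 _ _ t c _ rfl h⟩

/-- Above the first level each class is the image under one and the same `δ` of a lower class, and
the lower classes agree by induction. -/
theorem IsClassifying.cls_eq {i : ℕ} {𝒰 𝒰' : Cech.Cover (D.F 0)}
    {c : Cech.Cochain (S.shA i) 𝒰 (i + 2)} {c' : Cech.Cochain (S.shA i) 𝒰' (i + 2)}
    (hc : S.IsClassifying i 𝒰 c) (hc' : S.IsClassifying i 𝒰' c') :
    Cech.cls c hc.d_eq_one = Cech.cls c' hc'.d_eq_one := by
  induction i generalizing 𝒰 𝒰' with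
  | zero => exact IsClassifyingFirst.cls_eq hc hc'
  | succ i ih =>
    -- The degree is rewritten from `i + 1 + 2` to the definitionally equal `i + 2 + 1`, the form of
    -- the target of `δ`.
    have key (c : Cech.Cochain (S.shA (i + 1)) 𝒰 (i + 2 + 1))
        (c' : Cech.Cochain (S.shA (i + 1)) 𝒰' (i + 2 + 1)) (hc : S.IsClassifying (i + 1) 𝒰 c)
        (hc' : S.IsClassifying (i + 1) 𝒰' c') :
        Cech.cls c hc.d_eq_one = Cech.cls c' hc'.d_eq_one := by
      obtain ⟨δ, hδ, -⟩ := (S.isShortExact i).existsUnique_connecting (p := i + 2) (by simp)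
      obtain ⟨c₀, hc₀, h⟩ := IsClassifying.exists_connecting hc
      obtain ⟨c₀', hc₀', h'⟩ := IsClassifying.exists_connecting hc'
      rw [← h δ hδ, ← h' δ hδ, ih hc₀ hc₀']
    exact key c c' hc hc'

variable (S)

/-- A lower classifying cocycle lifts to `E i` after pullback along some `τ`, and the pullback is
still classifying. -/
theorem exists_isClassifying : ∀ i, ∃ 𝒰 c, S.IsClassifying i 𝒰 c
  | 0 => S.exists_isClassifyingFirst
  | i + 1 => by
    obtain ⟨𝒰, c, hc⟩ := exists_isClassifying i
    obtain ⟨𝒱, -, τ, hτ, t, ht⟩ := (S.isShortExact i).exists_lift c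
    have hp := ht ▸ IsClassifying.pull S hc hτ
    obtain ⟨a, -, ha⟩ := (S.isShortExact i).exists_boundary t hp.d_eq_one
    exact ⟨𝒱, a, (isClassifying_succ_iff fun c hc => hc.d_eq_one).2 ⟨t, hp, ha⟩⟩

end Tower.Sheaves

theorem proposition4 (D : LiftingProblem) (T : Tower D) (S : T.Sheaves) (i : ℕ) :
    -- the `(i + 1)`- and the `(i + 2)`-lifting problem have classifying cocycles
    (∃ 𝒰 c, S.IsClassifying i 𝒰 c) ∧ (∃ 𝒰 c, S.IsClassifying (i + 1) 𝒰 c) ∧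
    -- there is exactly one connecting homomorphism of `A (i + 1) → E i → A i`, and it maps the class
    -- of every classifying cocycle of the former to that of every classifying cocycle of the latter
    ∃ δ : Cech.H (S.shA i) (i + 2) →* Cech.H (S.shA (i + 1)) (i + 2 + 1),
      Cech.IsConnecting (S.incl i) (S.toA i) (i + 2) δ ∧
      (∀ δ', Cech.IsConnecting (S.incl i) (S.toA i) (i + 2) δ' → δ' = δ) ∧
      ∀ 𝒰 c 𝒰' c', S.IsClassifying i 𝒰 c → S.IsClassifying (i + 1) 𝒰' c' →
        ∃ (hc : Cech.d (S.shA i) 𝒰 (i + 2) c = 1)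
          (hc' : Cech.d (S.shA (i + 1)) 𝒰' (i + 2 + 1) c' = 1),
          δ (Cech.cls c hc) = Cech.cls c' hc' := by
  obtain ⟨δ, hδ, huniq⟩ := (S.isShortExact i).existsUnique_connecting (p := i + 2) (by simp)
  refine ⟨S.exists_isClassifying i, S.exists_isClassifying (i + 1), δ, hδ, huniq, ?_⟩
  intro 𝒰 c 𝒰' c' hc hc'
  -- The cocycle `c₀` from which `c'` was formed need not be `c`, but it has the same class.
  obtain ⟨c₀, hc₀, h⟩ := hc'.exists_connecting
  exact ⟨hc.d_eq_one, hc'.d_eq_one, by rw [hc.cls_eq hc₀, h δ hδ]⟩
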